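/- For $x,q,r\in\mathbb C$ with $|q|,|r|<1$ let $(x;q,r)=\prod_{j,k=0}^\infty(1-xq^jr^k)$, and extend this symbol to all $q,r\neq 0$ with $|q|\ne1\ne|r|$ by the rules $(x;q^{-1},r)=1/(qx;q,r)$ and $(x;q,r^{-1})=1/(rx;q,r)$. For $\tau,\sigma\in\mathbb C\setminus\mathbb R$ the elliptic gamma function is the meromorphic function of $z\in\mathbb C$ $$\Gamma(z,\tau,\sigma)=\frac{(qr/x;q,r)}{(x;q,r)},\qquad x=e^{2\pi iz},\ q=e^{2\pi i\tau},\ r=e^{2\pi i\sigma}.$$ **Theorem (modular three-term relations).** Suppose that $\tau,\sigma,\sigma/\tau,\tau+\sigma\in\mathbb C\setminus\mathbb R$. Let $$Q(z;\tau,\sigma)=\frac{z^3}{3\tau\sigma}-\frac{\tau+\sigma-1}{2\tau\sigma}z^2+\frac{\tau^2+\sigma^2+3\tau\sigma-3\tau-3\sigma+1}{6\tau\sigma}z+\frac1{12}(\tau+\sigma-1)(\tau^{-1}+\sigma^{-1}-1).$$ Then $$\Gamma(z,\tau+1,\sigma)=\Gamma(z,\tau,\sigma+1)=\Gamma(z,\tau,\sigma),$$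 $$\Gamma(z,\tau+\sigma,\sigma)=\frac{\Gamma(z,\tau,\sigma)}{\Gamma(z+\tau,\tau,\sigma+\tau)},$$ $$\Gamma\Big(\frac z\sigma,\frac\tau\sigma,-\frac1\sigma\Big)=e^{i\pi Q(z;\tau,\sigma)}\,\Gamma\Big(\frac{z-\sigma}\tau,-\frac1\tau,-\frac\sigma\tau\Big)\,\Gamma(z,\tau,\sigma),$$ $$\Gamma\Big(\frac z\tau,-\frac1\tau,\frac\sigma\tau\Big)=e^{i\pi Q(z;\tau,\sigma)}\,\Gamma\Big(\frac{z-\tau}\sigma,-\frac\tau\sigma,-\frac1\sigma\Big)\,\Gamma(z,\tau,\sigma).$$ These are identities of meromorphic functions of $z\in\mathbb C$. They also hold between values at every $z$ at which the gamma functions on the right-hand side have no pole (and, in the second identity, the denominator does not vanish). -/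

import Mathlib

open Filter

noncomputable section

namespace EllipticGamma

/-- The double infinite product `∏_{j,k ≥ 0} (1 - x q^j r^k)`, used for `‖q‖ < 1` and `‖r‖ < 1`
(where it converges absolutely for every `x`). -/
def doubleProd (x q r : ℂ) : ℂ :=
  ∏' p : ℕ × ℕ, (1 - x * q ^ p.1 * r ^ p.2)

open Classical in
/-- The symbol `(x; q, r)` for nonzero `q`, `r` with `‖q‖ ≠ 1` and `‖r‖ ≠ 1`: the double product
when `‖q‖, ‖r‖ < 1`, extended by the rules
`(x; q⁻¹, r) = 1 / (q x; q, r)` and `(x; q, r⁻¹) = 1 / (r x; q, r)`.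
(When both rules are used, the two inversions cancel.) -/
def symb (x q r : ℂ) : ℂ :=
  if ‖q‖ < 1 then
    if ‖r‖ < 1 then doubleProd x q r
    else (doubleProd (r⁻¹ * x) q r⁻¹)⁻¹
  else
    if ‖r‖ < 1 then (doubleProd (q⁻¹ * x) q⁻¹ r)⁻¹
    else doubleProd (q⁻¹ * r⁻¹ * x) q⁻¹ r⁻¹

/-- `e(z) = exp (2πiz)`. -/
def e (z : ℂ) : ℂ := Complex.exp (2 * Real.pi * Complex.I * z)

/-- The elliptic gamma function `Γ(z, τ, σ) = (qr/x; q, r) / (x; q, r)`, with `x = e(z)`,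
`q = e(τ)`, `r = e(σ)`, for non-real `τ`, `σ`.  At a pole in `z` the value is `0` by the
convention for division by zero. -/
def Gam (z τ σ : ℂ) : ℂ :=
  symb (e τ * e σ / e z) (e τ) (e σ) / symb (e z) (e τ) (e σ)

/-- `z` is a pole of the function `Γ(·, τ, σ)`. -/
def IsPole (z τ σ : ℂ) : Prop :=
  meromorphicOrderAt (fun w => Gam w τ σ) z < 0

/-- `f` and `g` are meromorphic on `ℂ` and equal as meromorphic functions, that is, their values
agree off a closed discrete set. -/
def MeroEq (f g : ℂ → ℂ) : Prop :=
  Meromorphic f ∧ Meromorphic g ∧ f =ᶠ[codiscrete ℂ] g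

/-- The polynomial `Q(z; τ, σ)`, cubic in `z`. -/
def Q (z τ σ : ℂ) : ℂ :=
  z ^ 3 / (3 * τ * σ)
    - (τ + σ - 1) / (2 * τ * σ) * z ^ 2
    + (τ ^ 2 + σ ^ 2 + 3 * τ * σ - 3 * τ - 3 * σ + 1) / (6 * τ * σ) * z
    + 1 / 12 * (τ + σ - 1) * (τ⁻¹ + σ⁻¹ - 1)

end EllipticGamma

end

/-!
For periods `a`, `b`, `c`, the modular relation reads
`Γ(z/c, a/c, b/c) Γ(z/a, b/a, c/a) Γ(z/b, c/b, a/b) exp (iπ B₃₃(z | a, b, c) / 3) = 1`.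
The shift `z ↦ z + a` multiplies the left-hand side by
`θ(z/c, b/c) θ(z/b, c/b) exp (iπ B₂₂(z | b, c))`, which is constant by the modular transformation of
`θ`, and the duplication formula of `θ` shows that the cube of this constant is one. Hence the
absolute value of the left-hand side is invariant under the group `Λ` generated by the periods.
Outside the countable set `Λ` the three gamma functions have neither zeros nor poles, and a sign
argument provides a point of `Λ` at which none of them has a pole. Translating by `Λ` into a compact
set, the left-hand side, a quotient `N / D` of entire functions, satisfies `|N| ≤ M |D|`, so it is
constant by Liouville's theorem; at `z = (a + b + c) / 2` all factors are one. The transformation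
of `θ` itself follows by the same use of Liouville's theorem, after dividing out the zero at the
origin.

When `τ` and `σ` lie in the upper half plane, the additive relation is the splitting of the double
product along the diagonal of `ℕ × ℕ`; the other cases follow by reflecting the parameters.

Both relations are obtained off a countable set, which gives the identities of meromorphic
functions. Writing a gamma function as `N / D` without common zeros, an identity `N = f D` at a
point where `f` is continuous forces `D ≠ 0` there, hence the identities between values.
-/

namespace EllipticGamma

open scoped Topology

/-! ### Double infinite products -/

theorem tprod_eq_mul_of_isCompl_range {M α β γ : Type*} [CommMonoid M] [TopologicalSpace M]
    [ContinuousMul M] [T2Space M] {f : α → M} {i : β → α} {j : γ → α} (hi : i.Injective)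
    (hj : j.Injective) (h : IsCompl (Set.range i) (Set.range j)) (hfi : Multipliable (f ∘ i))
    (hfj : Multipliable (f ∘ j)) : ∏' a, f a = (∏' b, f (i b)) * ∏' c, f (j c) :=
  (HasProd.mul_isCompl h (hi.hasProd_range_iff.2 hfi.hasProd)
    (hj.hasProd_range_iff.2 hfj.hasProd)).tprod_eq

theorem summable_norm_mul_pow_mul_pow {q r : ℂ} (hq : ‖q‖ < 1) (hr : ‖r‖ < 1) (x : ℂ) :
    Summable fun p : ℕ × ℕ => ‖x * q ^ p.1 * r ^ p.2‖ := by
  have h := (summable_geometric_of_lt_one (norm_nonneg q) hq).mul_of_nonneg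
    (summable_geometric_of_lt_one (norm_nonneg r) hr) (fun _ => by positivity)
    (fun _ => by positivity)
  refine (h.mul_left ‖x‖).congr fun p => ?_
  simp only [norm_mul, norm_pow, mul_assoc]

theorem multipliable_doubleProd {q r : ℂ} (hq : ‖q‖ < 1) (hr : ‖r‖ < 1) (x : ℂ) :
    Multipliable fun p : ℕ × ℕ => 1 - x * q ^ p.1 * r ^ p.2 := by
  simp_rw [sub_eq_add_neg]
  exact multipliable_one_add_of_summable
    (by simpa only [norm_neg] using summable_norm_mul_pow_mul_pow hq hr x)

theorem multipliable_one_sub_mul_pow {r : ℂ} (hr : ‖r‖ < 1) (x : ℂ) :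
    Multipliable fun k : ℕ => 1 - x * r ^ k := by
  simp_rw [sub_eq_add_neg]
  refine multipliable_one_add_of_summable ?_
  simpa only [norm_neg, norm_mul, norm_pow] using
    (summable_geometric_of_lt_one (norm_nonneg r) hr).mul_left ‖x‖

theorem differentiable_doubleProd {q r : ℂ} (hq : ‖q‖ < 1) (hr : ‖r‖ < 1) :
    Differentiable ℂ fun x => doubleProd x q r := by
  intro x
  have hprod : HasProdLocallyUniformlyOn
      (fun (p : ℕ × ℕ) (x : ℂ) => 1 + -(x * q ^ p.1 * r ^ p.2))
      (fun x => ∏' p : ℕ × ℕ, (1 + -(x * q ^ p.1 * r ^ p.2)))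
      (Metric.ball (0 : ℂ) (‖x‖ + 1)) := by
    refine Summable.hasProdLocallyUniformlyOn_one_add Metric.isOpen_ball
      (summable_norm_mul_pow_mul_pow hq hr ((‖x‖ + 1 : ℝ) : ℂ))
      (.of_forall fun p y hy => ?_) fun p => by fun_prop
    rw [mem_ball_zero_iff] at hy
    have h0 : 0 ≤ ‖x‖ + 1 := by positivity
    simp only [norm_neg, norm_mul, Complex.norm_real, Real.norm_of_nonneg h0]
    gcongr
  have hdiff := hprod.differentiableOn
    (.of_forall fun _ => by
      simpa [Finset.prod_fn] using DifferentiableOn.finsetProd (fun _ _ => by fun_prop))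
    Metric.isOpen_ball
  simpa only [doubleProd, sub_eq_add_neg] using
    hdiff.differentiableAt (Metric.isOpen_ball.mem_nhds (by simp : x ∈ Metric.ball 0 (‖x‖ + 1)))

theorem doubleProd_ne_zero {q r x : ℂ} (hq : ‖q‖ < 1) (hr : ‖r‖ < 1)
    (hx : ∀ j k : ℕ, x * q ^ j * r ^ k ≠ 1) : doubleProd x q r ≠ 0 := by
  simp_rw [doubleProd, sub_eq_add_neg]
  refine tprod_one_add_ne_zero_of_summable (fun p h => hx p.1 p.2 ?_)
    (by simpa only [norm_neg] using summable_norm_mul_pow_mul_pow hq hr x)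
  linear_combination -h

theorem doubleProd_ne_zero_of_norm_lt_one {q r x : ℂ} (hq : ‖q‖ < 1) (hr : ‖r‖ < 1)
    (hx : ‖x‖ < 1) : doubleProd x q r ≠ 0 := by
  refine doubleProd_ne_zero hq hr fun j k h => ?_
  have hlt : ‖x * q ^ j * r ^ k‖ < 1 := by
    rw [norm_mul, norm_mul, norm_pow, norm_pow, mul_assoc]
    exact mul_lt_one_of_nonneg_of_lt_one_left (norm_nonneg _) hx
      (mul_le_one₀ (pow_le_one₀ (norm_nonneg _) hq.le) (by positivity)
        (pow_le_one₀ (norm_nonneg _) hr.le))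
  rw [h, norm_one] at hlt
  exact lt_irrefl _ hlt

theorem doubleProd_comm (x q r : ℂ) : doubleProd x q r = doubleProd x r q := by
  rw [doubleProd, ← (Equiv.prodComm ℕ ℕ).tprod_eq]
  exact tprod_congr fun p => by simp only [Equiv.prodComm_apply, Prod.fst_swap, Prod.snd_swap]; ring

-- Since `0 ^ 0 = 1`, the simple product `(x; r) = ∏ (1 - x r ^ k)` is the double product at
-- `q = 0`, and needs no definition of its own.
theorem doubleProd_zero_left (x r : ℂ) : doubleProd x 0 r = ∏' k : ℕ, (1 - x * r ^ k) := by
  have hi : Function.Injective fun k : ℕ => ((0, k) : ℕ × ℕ) := Prod.mk_right_injective 0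
  rw [doubleProd, ← hi.tprod_eq]
  · simp only [pow_zero, mul_one]
  · rintro ⟨j, k⟩ h
    rcases Nat.eq_zero_or_pos j with rfl | hj
    · exact ⟨k, rfl⟩
    · simp [hj.ne'] at h

theorem doubleProd_eq_mul_left {q r : ℂ} (hq : ‖q‖ < 1) (hr : ‖r‖ < 1) (x : ℂ) :
    doubleProd x q r = doubleProd x 0 r * doubleProd (q * x) q r := by
  let i : ℕ → ℕ × ℕ := fun k => (0, k)
  let j : ℕ × ℕ → ℕ × ℕ := fun p => (p.1 + 1, p.2)
  have hi : Set.range i = {p | p.1 = 0} := by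
    ext ⟨m, n⟩
    simp [i, eq_comm]
  have hj : Set.range j = {p | p.1 = 0}ᶜ := by
    ext ⟨m, n⟩
    cases m <;> simp [j]
  rw [doubleProd_zero_left, doubleProd, doubleProd,
    tprod_eq_mul_of_isCompl_range (i := i) (j := j) (fun _ _ => by simp [i])
      (fun _ _ => by simp [j, Prod.ext_iff]) (by rw [hi, hj]; exact isCompl_compl)
      ((multipliable_one_sub_mul_pow hr x).congr fun k => by simp [i])
      ((multipliable_doubleProd hq hr (q * x)).congr fun p => by
        simp only [Function.comp, j]; ring)]
  congr 1
  · exact tprod_congr fun k => by simp only [i, pow_zero, mul_one]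
  · exact tprod_congr fun p => by ring

theorem doubleProd_add {q r : ℂ} (hq : ‖q‖ < 1) (hr : ‖r‖ < 1) (x : ℂ) :
    doubleProd x q r = doubleProd x (q * r) r * doubleProd (q * x) q (q * r) := by
  have hqr : ‖q * r‖ < 1 := by
    rw [norm_mul]; exact mul_lt_one_of_nonneg_of_lt_one_left (norm_nonneg _) hq hr.le
  let i : ℕ × ℕ → ℕ × ℕ := fun p => (p.1, p.1 + p.2)
  let j : ℕ × ℕ → ℕ × ℕ := fun p => (1 + p.1 + p.2, p.2)
  have hi : Set.range i = {p | p.1 ≤ p.2} := by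
    ext ⟨m, n⟩
    simp [i, le_iff_exists_add, eq_comm]
  have hj : Set.range j = {p | p.1 ≤ p.2}ᶜ := by
    ext ⟨m, n⟩
    simp only [j, Set.mem_range, Prod.exists, Prod.mk.injEq, Set.mem_compl_iff, Set.mem_ofPred_eq]
    exact ⟨by omega, fun h => ⟨m - n - 1, n, by omega, rfl⟩⟩
  rw [doubleProd, doubleProd, doubleProd,
    tprod_eq_mul_of_isCompl_range (i := i) (j := j) (fun _ _ => by simp [i, Prod.ext_iff]; omega)
      (fun _ _ => by simp [j, Prod.ext_iff]; omega) (by rw [hi, hj]; exact isCompl_compl)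
      ((multipliable_doubleProd hqr hr x).congr fun p => by simp only [Function.comp, i]; ring)
      ((multipliable_doubleProd hq hqr (q * x)).congr fun p => by
        simp only [Function.comp, j]; ring)]
  congr 1
  · exact tprod_congr fun p => by ring
  · exact tprod_congr fun p => by ring

theorem doubleProd_zero_eq_one_sub_mul {r : ℂ} (hr : ‖r‖ < 1) (x : ℂ) :
    doubleProd x 0 r = (1 - x) * doubleProd (r * x) 0 r := by
  have h : doubleProd x 0 0 = 1 - x := by
    rw [doubleProd_zero_left, tprod_eq_mulSingle 0 fun k hk => by simp [hk], pow_zero, mul_one]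
  rw [doubleProd_comm x 0 r, doubleProd_eq_mul_left hr (by simp) x, h,
    doubleProd_comm (r * x) 0 r]

theorem doubleProd_zero_mul_doubleProd_neg {r : ℂ} (hr : ‖r‖ < 1) (x : ℂ) :
    doubleProd x 0 r * doubleProd (-x) 0 r = doubleProd (x ^ 2) 0 (r ^ 2) := by
  simp_rw [doubleProd_zero_left]
  rw [← (multipliable_one_sub_mul_pow hr x).tprod_mul (multipliable_one_sub_mul_pow hr (-x))]
  exact tprod_congr fun k => by ring

theorem doubleProd_zero_sq_mul {s : ℂ} (hs : ‖s‖ < 1) (x : ℂ) :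
    doubleProd x 0 (s ^ 2) * doubleProd (s * x) 0 (s ^ 2) = doubleProd x 0 s := by
  have hs2 : ‖s ^ 2‖ < 1 := by
    rw [norm_pow]; exact pow_lt_one₀ (norm_nonneg _) hs two_ne_zero
  simp_rw [doubleProd_zero_left]
  rw [← tprod_even_mul_odd (f := fun k : ℕ => 1 - x * s ^ k)
    ((multipliable_one_sub_mul_pow hs2 x).congr fun k => by ring)
    ((multipliable_one_sub_mul_pow hs2 (s * x)).congr fun k => by ring)]
  congr 1
  · exact tprod_congr fun k => by ring
  · exact tprod_congr fun k => by ring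

theorem doubleProd_zero_duplication {s : ℂ} (hs : ‖s‖ < 1) (x : ℂ) :
    doubleProd x 0 (s ^ 2) * doubleProd (-x) 0 (s ^ 2) *
      (doubleProd (s * x) 0 (s ^ 2) * doubleProd (-(s * x)) 0 (s ^ 2)) =
      doubleProd (x ^ 2) 0 (s ^ 2) := by
  rw [← doubleProd_zero_mul_doubleProd_neg hs, ← doubleProd_zero_sq_mul hs x,
    ← doubleProd_zero_sq_mul hs (-x), mul_neg]
  ring

/-! ### The exponential and the symbol `(x; q, r)` -/

theorem e_ne_zero (z : ℂ) : e z ≠ 0 := Complex.exp_ne_zero _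

theorem e_add (z w : ℂ) : e (z + w) = e z * e w := by
  rw [e, e, e, ← Complex.exp_add, mul_add]

theorem e_neg (z : ℂ) : e (-z) = (e z)⁻¹ := by
  rw [e, e, ← Complex.exp_neg, mul_neg]

theorem e_sub (z w : ℂ) : e (z - w) = e z / e w := by
  rw [e, e, e, ← Complex.exp_sub, mul_sub]

theorem e_int_mul (n : ℤ) (z : ℂ) : e (n * z) = e z ^ n := by
  rw [e, e, ← Complex.exp_int_mul, mul_left_comm]

theorem e_two_mul (z : ℂ) : e (2 * z) = e z ^ 2 := by
  exact_mod_cast e_int_mul 2 z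

theorem e_eq_one_iff {z : ℂ} : e z = 1 ↔ ∃ n : ℤ, z = n := by
  rw [e, Complex.exp_eq_one_iff]
  refine exists_congr fun n => ?_
  rw [mul_comm (n : ℂ)]
  exact mul_right_inj' Complex.two_pi_I_ne_zero

theorem e_zero : e 0 = 1 := e_eq_one_iff.2 ⟨0, by simp⟩

theorem e_one : e 1 = 1 := e_eq_one_iff.2 ⟨1, by simp⟩

theorem e_add_one (z : ℂ) : e (z + 1) = e z := by rw [e_add, e_one, mul_one]

theorem norm_e (z : ℂ) : ‖e z‖ = Real.exp (-(2 * Real.pi * z.im)) := by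
  rw [e, Complex.norm_exp]; simp

theorem norm_e_lt_one_iff {z : ℂ} : ‖e z‖ < 1 ↔ 0 < z.im := by
  rw [norm_e, Real.exp_lt_one_iff, neg_lt_zero, mul_pos_iff_of_pos_left Real.two_pi_pos]

theorem norm_e_ne_one {z : ℂ} (hz : z.im ≠ 0) : ‖e z‖ ≠ 1 := by
  rw [norm_e, Ne, Real.exp_eq_one_iff, neg_eq_zero]
  exact mul_ne_zero Real.two_pi_pos.ne' hz

theorem differentiable_e : Differentiable ℂ e := by
  unfold e; fun_prop

theorem sub_mem_iff_of_mem {G : Type*} [AddGroup G] {H : AddSubgroup G} {w z : G} (hw : w ∈ H) :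
    w - z ∈ H ↔ z ∈ H := by
  rw [sub_eq_add_neg, add_mem_cancel_left hw, neg_mem_iff]

theorem div_notMem_addSubgroupClosure {K : Type*} [Field K] {s t : Set K} {b z : K} (hb : b ≠ 0)
    (h : ∀ w ∈ s, b * w ∈ AddSubgroup.closure t) (hz : z ∉ AddSubgroup.closure t) :
    z / b ∉ AddSubgroup.closure s := fun hmem => hz <| by
  have hle : AddSubgroup.closure s ≤
      (AddSubgroup.closure t).comap (AddMonoidHom.mulLeft b) := (AddSubgroup.closure_le _).2 h
  simpa only [AddSubgroup.mem_comap, AddMonoidHom.coe_mulLeft, mul_div_cancel₀ _ hb] using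
    hle hmem

theorem e_mul_zpow_mul_zpow_ne_one {z τ σ : ℂ} (hz : z ∉ AddSubgroup.closure {1, τ, σ})
    (j k : ℤ) : e z * e τ ^ j * e σ ^ k ≠ 1 := by
  rw [← e_int_mul, ← e_int_mul, ← e_add, ← e_add, Ne, e_eq_one_iff]
  rintro ⟨n, hn⟩
  have hmem : n • (1 : ℂ) - j • τ - k • σ ∈ AddSubgroup.closure {1, τ, σ} :=
    sub_mem (sub_mem (zsmul_mem (AddSubgroup.mem_closure_of_mem (by simp)) n)
      (zsmul_mem (AddSubgroup.mem_closure_of_mem (by simp)) j))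
      (zsmul_mem (AddSubgroup.mem_closure_of_mem (by simp)) k)
  refine hz ?_
  convert hmem using 1
  simp only [zsmul_eq_mul]
  linear_combination hn

theorem norm_inv_lt_one_iff {q : ℂ} (h0 : q ≠ 0) (hq : ‖q‖ ≠ 1) : ‖q⁻¹‖ < 1 ↔ ¬ ‖q‖ < 1 := by
  rw [norm_inv, inv_lt_one₀ (norm_pos_iff.2 h0), not_lt]
  exact ⟨le_of_lt, fun h => lt_of_le_of_ne h hq.symm⟩

theorem norm_inv_lt_one {q : ℂ} (hq : ‖q‖ ≠ 1) (h : ¬ ‖q‖ < 1) : ‖q⁻¹‖ < 1 := by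
  rw [norm_inv]
  exact inv_lt_one_of_one_lt₀ (lt_of_le_of_ne (not_lt.1 h) hq.symm)

theorem symb_of_norm_lt_one (x : ℂ) {q r : ℂ} (hq : ‖q‖ < 1) (hr : ‖r‖ < 1) :
    symb x q r = doubleProd x q r := by
  rw [symb, if_pos hq, if_pos hr]

theorem symb_comm (x q r : ℂ) : symb x q r = symb x r q := by
  unfold symb
  split_ifs
  · exact doubleProd_comm _ _ _
  · rw [doubleProd_comm]
  · rw [doubleProd_comm]
  · rw [doubleProd_comm, mul_comm q⁻¹]

theorem symb_inv_right (x q : ℂ) {r : ℂ} (h0 : r ≠ 0) (hr : ‖r‖ ≠ 1) :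
    symb x q r⁻¹ = (symb (r * x) q r)⁻¹ := by
  unfold symb
  simp only [norm_inv_lt_one_iff h0 hr]
  split_ifs <;> simp [h0, mul_assoc]

theorem symb_inv_left (x : ℂ) {q : ℂ} (r : ℂ) (h0 : q ≠ 0) (hq : ‖q‖ ≠ 1) :
    symb x q⁻¹ r = (symb (q * x) q r)⁻¹ := by
  rw [symb_comm, symb_inv_right x r h0 hq, symb_comm]

theorem symb_ne_zero {x q r : ℂ} (hq : ‖q‖ ≠ 1) (hr : ‖r‖ ≠ 1)
    (hx : ∀ j k : ℤ, x * q ^ j * r ^ k ≠ 1) : symb x q r ≠ 0 := by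
  have zpow_eq {q : ℂ} (h : ¬ ‖q‖ < 1) (j : ℕ) : q ^ (-(j + 1) : ℤ) = q⁻¹ * q⁻¹ ^ j := by
    have h0 : q ≠ 0 := by rintro rfl; simp at h
    rw [← inv_zpow', zpow_add_one₀ (inv_ne_zero h0), zpow_natCast, mul_comm]
  unfold symb
  split_ifs with hq1 hr1 hr1
  · exact doubleProd_ne_zero hq1 hr1 fun j k => mod_cast hx j k
  · refine inv_ne_zero (doubleProd_ne_zero hq1 (norm_inv_lt_one hr hr1) fun j k h =>
      hx j (-(k + 1)) ?_)
    rw [← h, zpow_eq hr1, zpow_natCast]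
    ring
  · refine inv_ne_zero (doubleProd_ne_zero (norm_inv_lt_one hq hq1) hr1 fun j k h =>
      hx (-(j + 1)) k ?_)
    rw [← h, zpow_eq hq1, zpow_natCast]
    ring
  · refine doubleProd_ne_zero (norm_inv_lt_one hq hq1) (norm_inv_lt_one hr hr1) fun j k h =>
      hx (-(j + 1)) (-(k + 1)) ?_
    rw [← h, zpow_eq hq1, zpow_eq hr1]
    ring

theorem symb_zero_left_ne_zero {x r : ℂ} (hr : ‖r‖ ≠ 1) (hx : ∀ k : ℤ, x * r ^ k ≠ 1) :
    symb x 0 r ≠ 0 := by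
  refine symb_ne_zero (by simp) hr fun j k => ?_
  rcases eq_or_ne j 0 with rfl | hj
  · simpa using hx k
  · simp [zero_zpow _ hj]

theorem symb_eq_mul_left {x q r : ℂ} (hq : ‖q‖ ≠ 1) (hr : ‖r‖ ≠ 1) (hx : symb x 0 r ≠ 0) :
    symb x q r = symb x 0 r * symb (q * x) q r := by
  by_cases hq1 : ‖q‖ < 1
  · by_cases hr1 : ‖r‖ < 1
    · simp only [symb, norm_zero, zero_lt_one, hq1, hr1, if_true]
      exact doubleProd_eq_mul_left hq1 hr1 x
    · simp only [symb, norm_zero, zero_lt_one, hq1, hr1, if_true, if_false]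
      rw [doubleProd_eq_mul_left hq1 (norm_inv_lt_one hr hr1), mul_inv, mul_left_comm]
  · have hq0 : q ≠ 0 := by rintro rfl; simp at hq1
    have hq2 := norm_inv_lt_one hq hq1
    by_cases hr1 : ‖r‖ < 1
    · simp only [symb, norm_zero, zero_lt_one, hq1, hr1, if_true, if_false] at hx ⊢
      rw [inv_mul_cancel_left₀ hq0, doubleProd_eq_mul_left hq2 hr1 x, mul_inv,
        mul_inv_cancel_left₀ hx]
    · simp only [symb, norm_zero, zero_lt_one, hq1, hr1, if_true, if_false, mul_assoc] at hx ⊢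
      rw [mul_left_comm r⁻¹ q, inv_mul_cancel_left₀ hq0,
        doubleProd_eq_mul_left hq2 (norm_inv_lt_one hr hr1) (r⁻¹ * x),
        inv_mul_cancel_left₀ fun h => hx (by rw [h, inv_zero])]

/-! ### The elliptic gamma function -/

theorem Gam_eq (z τ σ : ℂ) :
    Gam z τ σ = symb (e (τ + σ - z)) (e τ) (e σ) / symb (e z) (e τ) (e σ) := by
  rw [Gam, e_sub, e_add]

theorem Gam_comm (z τ σ : ℂ) : Gam z τ σ = Gam z σ τ := by
  rw [Gam, Gam, symb_comm, symb_comm (e z), mul_comm (e τ)]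

theorem isPole_comm (z τ σ : ℂ) : IsPole z τ σ ↔ IsPole z σ τ := by
  simp only [IsPole, Gam_comm _ τ σ]

theorem Gam_add_one (z τ σ : ℂ) : Gam (z + 1) τ σ = Gam z τ σ := by
  rw [Gam, Gam, e_add_one]

theorem Gam_add_one_left (z τ σ : ℂ) : Gam z (τ + 1) σ = Gam z τ σ := by
  rw [Gam, Gam, e_add_one]

theorem Gam_add_one_right (z τ σ : ℂ) : Gam z τ (σ + 1) = Gam z τ σ := by
  rw [Gam, Gam, e_add_one]

theorem Gam_reflect (z τ σ : ℂ) : Gam (τ + σ - z) τ σ = (Gam z τ σ)⁻¹ := by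
  rw [Gam_eq, Gam_eq, inv_div, sub_sub_cancel]

theorem Gam_neg_left (z : ℂ) {τ : ℂ} (σ : ℂ) (hτ : τ.im ≠ 0) :
    Gam z (-τ) σ = (Gam (z + τ) τ σ)⁻¹ := by
  rw [Gam_eq, Gam_eq, e_neg, symb_inv_left _ _ (e_ne_zero τ) (norm_e_ne_one hτ),
    symb_inv_left _ _ (e_ne_zero τ) (norm_e_ne_one hτ), ← e_add, ← e_add, inv_div_inv, inv_div]
  ring_nf

theorem Gam_neg_right (z τ : ℂ) {σ : ℂ} (hσ : σ.im ≠ 0) :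
    Gam z τ (-σ) = (Gam (z + σ) τ σ)⁻¹ := by
  rw [Gam_comm, Gam_neg_left _ _ hσ, Gam_comm]

theorem Gam_neg_neg (z : ℂ) {τ σ : ℂ} (hτ : τ.im ≠ 0) (hσ : σ.im ≠ 0) :
    Gam (-z) (-τ) (-σ) = (Gam z τ σ)⁻¹ := by
  rw [Gam_neg_left _ _ hτ, Gam_neg_right _ _ hσ, inv_inv, ← Gam_reflect]
  ring_nf

theorem symb_e_ne_zero {z τ σ : ℂ} (hτ : τ.im ≠ 0) (hσ : σ.im ≠ 0)
    (hz : z ∉ AddSubgroup.closure {1, τ, σ}) : symb (e z) (e τ) (e σ) ≠ 0 :=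
  symb_ne_zero (norm_e_ne_one hτ) (norm_e_ne_one hσ) (e_mul_zpow_mul_zpow_ne_one hz)

theorem Gam_ne_zero {z τ σ : ℂ} (hτ : τ.im ≠ 0) (hσ : σ.im ≠ 0)
    (hz : z ∉ AddSubgroup.closure {1, τ, σ}) : Gam z τ σ ≠ 0 := by
  have hmem : τ + σ ∈ AddSubgroup.closure {1, τ, σ} :=
    add_mem (AddSubgroup.mem_closure_of_mem (by simp)) (AddSubgroup.mem_closure_of_mem (by simp))
  rw [Gam_eq]
  exact div_ne_zero
    (symb_e_ne_zero hτ hσ ((sub_mem_iff_of_mem hmem).not.2 hz))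
    (symb_e_ne_zero hτ hσ hz)

/-- The open strip of half-width `(|Im τ| + |Im σ|) / 2` around the centre `(τ + σ) / 2` of the
reflection `z ↦ τ + σ - z`; for all signs of `Im τ` and `Im σ` it is free of zeros and poles of
`Γ(·, τ, σ)`. -/
def strip (τ σ : ℂ) : Set ℂ := {z | |(2 * z - τ - σ).im| < |τ.im| + |σ.im|}

theorem strip_comm (τ σ : ℂ) : strip τ σ = strip σ τ := by
  simp only [strip, sub_right_comm _ τ, add_comm |τ.im|]

theorem mem_strip_neg_left_iff {z τ σ : ℂ} : z ∈ strip (-τ) σ ↔ z + τ ∈ strip τ σ := by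
  rw [strip, strip, Set.mem_ofPred_eq, Set.mem_ofPred_eq, Complex.neg_im, abs_neg,
    show 2 * z - -τ - σ = 2 * (z + τ) - τ - σ by ring]

/-- `N / D` is a presentation of `Γ(·, τ, σ)` as a quotient of entire functions without common
zeros and without zeros in `strip τ σ`. -/
structure IsReducedQuotient (τ σ : ℂ) (N D : ℂ → ℂ) : Prop where
  differentiable_num : Differentiable ℂ N
  differentiable_den : Differentiable ℂ D
  Gam_eq_div : ∀ z, Gam z τ σ = N z / D z
  num_ne_zero_or_den_ne_zero : ∀ z, N z ≠ 0 ∨ D z ≠ 0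
  ne_zero_of_mem_strip : ∀ z ∈ strip τ σ, N z ≠ 0 ∧ D z ≠ 0

namespace IsReducedQuotient

variable {τ σ : ℂ} {N D : ℂ → ℂ}

theorem ne_zero_of_notMem (h : IsReducedQuotient τ σ N D) (hτ : τ.im ≠ 0) (hσ : σ.im ≠ 0) {z : ℂ}
    (hz : z ∉ AddSubgroup.closure {1, τ, σ}) : N z ≠ 0 ∧ D z ≠ 0 :=
  div_ne_zero_iff.1 (h.Gam_eq_div z ▸ Gam_ne_zero hτ hσ hz)

theorem symm (h : IsReducedQuotient τ σ N D) : IsReducedQuotient σ τ N D where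
  differentiable_num := h.differentiable_num
  differentiable_den := h.differentiable_den
  Gam_eq_div z := by rw [Gam_comm, h.Gam_eq_div]
  num_ne_zero_or_den_ne_zero := h.num_ne_zero_or_den_ne_zero
  ne_zero_of_mem_strip := strip_comm τ σ ▸ h.ne_zero_of_mem_strip

theorem neg_left (h : IsReducedQuotient τ σ N D) (hτ : τ.im ≠ 0) :
    IsReducedQuotient (-τ) σ (fun z => D (z + τ)) (fun z => N (z + τ)) where
  differentiable_num := h.differentiable_den.comp (differentiable_id.add_const τ)
  differentiable_den := h.differentiable_num.comp (differentiable_id.add_const τ)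
  Gam_eq_div z := by rw [Gam_neg_left _ _ hτ, h.Gam_eq_div, inv_div]
  num_ne_zero_or_den_ne_zero z := (h.num_ne_zero_or_den_ne_zero _).symm
  ne_zero_of_mem_strip z hz := (h.ne_zero_of_mem_strip _ (mem_strip_neg_left_iff.1 hz)).symm

theorem of_im_pos (hτ : 0 < τ.im) (hσ : 0 < σ.im) :
    IsReducedQuotient τ σ (fun z => doubleProd (e (τ + σ - z)) (e τ) (e σ))
      (fun z => doubleProd (e z) (e τ) (e σ)) := by
  have hq := norm_e_lt_one_iff.2 hτ
  have hr := norm_e_lt_one_iff.2 hσ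
  have hne {z : ℂ} (hz : 0 < z.im) : doubleProd (e z) (e τ) (e σ) ≠ 0 :=
    doubleProd_ne_zero_of_norm_lt_one hq hr (norm_e_lt_one_iff.2 hz)
  refine ⟨(differentiable_doubleProd hq hr).comp
      (differentiable_e.comp (differentiable_id.const_sub (τ + σ))),
    (differentiable_doubleProd hq hr).comp differentiable_e, fun z => ?_, fun z => ?_,
    fun z hz => ?_⟩
  · rw [Gam_eq, symb_of_norm_lt_one _ hq hr, symb_of_norm_lt_one _ hq hr]
  · rcases lt_or_ge 0 z.im with hz | hz
    · exact Or.inr (hne hz)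
    · refine Or.inl (hne ?_)
      simp only [Complex.sub_im, Complex.add_im]; linarith
  · simp only [strip, Set.mem_ofPred_eq, abs_of_pos hτ, abs_of_pos hσ, abs_lt, Complex.sub_im,
      Complex.mul_im, Complex.re_ofNat, Complex.im_ofNat] at hz
    refine ⟨hne ?_, hne (by linarith)⟩
    simp only [Complex.sub_im, Complex.add_im]; linarith

end IsReducedQuotient

theorem exists_isReducedQuotient {τ σ : ℂ} (hτ : τ.im ≠ 0) (hσ : σ.im ≠ 0) :
    ∃ N D, IsReducedQuotient τ σ N D := by
  have neg {τ σ : ℂ} (hτ : τ.im ≠ 0) :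
      (∃ N D, IsReducedQuotient τ σ N D) → ∃ N D, IsReducedQuotient (-τ) σ N D :=
    fun ⟨_, _, h⟩ => ⟨_, _, h.neg_left hτ⟩
  have symm {τ σ : ℂ} : (∃ N D, IsReducedQuotient τ σ N D) → ∃ N D, IsReducedQuotient σ τ N D :=
    fun ⟨_, _, h⟩ => ⟨_, _, h.symm⟩
  wlog hτ0 : 0 < τ.im generalizing τ
  · have hτ' : (-τ).im ≠ 0 := by simpa using hτ
    exact neg_neg τ ▸ neg hτ' (this hτ' (by simpa using lt_of_le_of_ne (not_lt.1 hτ0) hτ))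
  wlog hσ0 : 0 < σ.im generalizing σ
  · have hσ' : (-σ).im ≠ 0 := by simpa using hσ
    exact symm (neg_neg σ ▸ neg hσ'
      (symm (this hσ' (by simpa using lt_of_le_of_ne (not_lt.1 hσ0) hσ))))
  exact ⟨_, _, .of_im_pos hτ0 hσ0⟩

theorem Gam_eq_one {z τ σ : ℂ} (hτ : τ.im ≠ 0) (hσ : σ.im ≠ 0) (hz : 2 * z - τ - σ = 1) :
    Gam z τ σ = 1 := by
  obtain ⟨N, D, h⟩ := exists_isReducedQuotient hτ hσ
  obtain ⟨hN, hD⟩ := h.ne_zero_of_mem_strip z (by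
    rw [strip, Set.mem_ofPred_eq, hz, Complex.one_im, abs_zero]
    positivity)
  have h0 : Gam z τ σ ≠ 0 := by rw [h.Gam_eq_div]; exact div_ne_zero hN hD
  have he : e (τ + σ - z) = e z := by
    rw [← e_add_one]
    congr 1
    linear_combination -hz
  rw [Gam_eq, he] at h0 ⊢
  exact div_self (div_ne_zero_iff.1 h0).2

/-! ### Liouville's theorem for quotients of entire functions -/

theorem countable_addSubgroupClosure {G : Type*} [AddCommGroup G] {s : Set G} (hs : s.Countable) :
    (AddSubgroup.closure s : Set G).Countable := by
  have : Countable s := hs.to_subtype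
  have h : Countable (Submodule.span ℤ (Set.range ((↑) : s → G))) := inferInstance
  rw [Subtype.range_coe] at h
  rw [← Submodule.span_int_eq_addSubgroupClosure]
  exact h

theorem apply_add_eq_of_mem_closure {G β : Type*} [AddCommGroup G] {s : Set G} {f : G → β}
    (hf : ∀ w ∈ s, ∀ z ∉ AddSubgroup.closure s, f (z + w) = f z) {w : G}
    (hw : w ∈ AddSubgroup.closure s) : ∀ z ∉ AddSubgroup.closure s, f (z + w) = f z := by
  induction hw using AddSubgroup.closure_induction with
  | mem w hw => exact hf w hw
  | zero => simp
  | add v w hv _ ihv ihw =>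
    intro z hz
    rw [← add_assoc, ihw _ (by rwa [add_mem_cancel_right hv]), ihv z hz]
  | neg w hw ih =>
    intro z hz
    rw [← ih (z + -w) (by rwa [add_mem_cancel_right (neg_mem hw)]), neg_add_cancel_right]

theorem bddAbove_image_inter_of_isCompact {X : Type*} [TopologicalSpace X] {K S : Set X} {f : X → ℝ}
    (hK : IsCompact K) (h : ∀ x ∈ K, IsBoundedUnder (· ≤ ·) (𝓝[S] x) f) :
    BddAbove (f '' (K ∩ S)) := by
  refine hK.induction_on (p := fun t => BddAbove (f '' (t ∩ S))) (by simp)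
    (fun s t hst ht => ht.mono (by gcongr)) (fun s t hs ht => ?_) fun x hx => ?_
  · rw [Set.union_inter_distrib_right, Set.image_union]
    exact hs.union ht
  · obtain ⟨M, hM⟩ := h x hx
    rw [eventually_map, eventually_nhdsWithin_iff] at hM
    exact ⟨_, mem_nhdsWithin_of_mem_nhds hM, M, Set.forall_mem_image.2 fun z hz => hz.1 hz.2⟩

theorem exists_norm_le_mul_norm_of_periodic {G 𝕜 : Type*} [AddCommGroup G] [TopologicalSpace G]
    [ContinuousAdd G] [NormedField 𝕜] {N D : G → 𝕜} (hN : Continuous N) (hD : Continuous D)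
    {Λ : AddSubgroup G} (hΛ : Dense (Λ : Set G)ᶜ) {K : Set G} (hK : IsCompact K)
    (hcov : ∀ z, ∃ w ∈ Λ, z + w ∈ K) (hD0 : ∀ z ∉ Λ, D z ≠ 0)
    {p : G} (hp : p ∈ Λ) (hDp : D p ≠ 0)
    (hper : ∀ w ∈ Λ, ∀ z ∉ Λ, ‖N (z + w) / D (z + w)‖ = ‖N z / D z‖) :
    ∃ M : ℝ, ∀ z, ‖N z‖ ≤ M * ‖D z‖ := by
  have hlocal (x : G) :
      IsBoundedUnder (· ≤ ·) (𝓝[(Λ : Set G)ᶜ] x) fun z => ‖N z / D z‖ := by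
    obtain ⟨w, hw, hxw⟩ : ∃ w ∈ Λ, D (x + w) ≠ 0 := by
      by_cases hx : x ∈ Λ
      · exact ⟨p - x, sub_mem hp hx, by simpa using hDp⟩
      · exact ⟨0, zero_mem Λ, by simpa using hD0 x hx⟩
    have hc : ContinuousAt (fun z => ‖N (z + w) / D (z + w)‖) x :=
      ((hN.comp (continuous_add_const w)).continuousAt.div
        (hD.comp (continuous_add_const w)).continuousAt hxw).norm
    refine isBoundedUnder_of_eventually_le (a := ‖N (x + w) / D (x + w)‖ + 1) ?_
    filter_upwards [nhdsWithin_le_nhds (hc.eventually_le_const (lt_add_one _)),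
      self_mem_nhdsWithin] with z hz hzΛ
    rwa [← hper w hw z hzΛ]
  obtain ⟨M, hM⟩ := bddAbove_image_inter_of_isCompact hK fun x _ => hlocal x
  refine ⟨M, fun z => ?_⟩
  have hclosed : IsClosed {z | ‖N z‖ ≤ M * ‖D z‖} := isClosed_le (by fun_prop) (by fun_prop)
  refine hclosed.closure_subset_iff.2 (fun z hz => ?_) (hΛ z)
  obtain ⟨w, hw, hzw⟩ := hcov z
  have hzwΛ : z + w ∉ Λ := by rwa [add_mem_cancel_right hw]
  have h := hM (Set.mem_image_of_mem _ ⟨hzw, hzwΛ⟩)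
  rwa [hper w hw z hz, norm_div, div_le_iff₀ (norm_pos_iff.2 (hD0 z hz))] at h

theorem exists_eventuallyEq_const_of_norm_le {f : ℂ → ℂ} (hf : Meromorphic f) {M : ℝ}
    (hM : ∀ z, ‖f z‖ ≤ M) : ∃ c, ∀ x, f =ᶠ[𝓝[≠] x] fun _ => c := by
  have hord (x : ℂ) : 0 ≤ meromorphicOrderAt f x := by
    by_contra! hneg
    obtain ⟨z, hz⟩ := ((tendsto_norm_atTop_iff_cobounded.2
      (tendsto_cobounded_of_meromorphicOrderAt_neg hneg)).eventually_gt_atTop M).exists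
    exact (hM z).not_gt hz
  let F : ℂ → ℂ := toMeromorphicNFOn f Set.univ
  have hFf (x : ℂ) : f =ᶠ[𝓝[≠] x] F :=
    (hf.meromorphicOn.toMeromorphicNFOn_eq_self_on_nhdsNE (Set.mem_univ x)).symm
  have hF : Differentiable ℂ F := fun x =>
    ((meromorphicNFOn_toMeromorphicNFOn f Set.univ
      (Set.mem_univ x)).meromorphicOrderAt_nonneg_iff_analyticAt.1
        (meromorphicOrderAt_toMeromorphicNFOn hf.meromorphicOn (Set.mem_univ x) ▸
          hord x)).differentiableAt
  have hFM (x : ℂ) : ‖F x‖ ≤ M := by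
    refine le_of_tendsto
      ((hF.continuous.norm.tendsto x).mono_left (nhdsWithin_le_nhds (s := {x}ᶜ))) ?_
    filter_upwards [hFf x] with z hz
    exact hz ▸ hM z
  obtain ⟨c, hc⟩ := hF.exists_const_forall_eq_of_bounded
    (isBounded_iff_forall_norm_le.2 ⟨M, Set.forall_mem_range.2 hFM⟩)
  exact ⟨c, fun x => (hFf x).trans (.of_forall hc)⟩

theorem exists_eq_const_mul_of_norm_le {N D : ℂ → ℂ} (hN : Differentiable ℂ N)
    (hD : Differentiable ℂ D) {M : ℝ} (h : ∀ z, ‖N z‖ ≤ M * ‖D z‖) :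
    ∃ c, ∀ z, N z = c * D z := by
  have hmero : Meromorphic (N / D) := fun z =>
    (hN.analyticAt z).meromorphicAt.div (hD.analyticAt z).meromorphicAt
  obtain ⟨c, hc⟩ := exists_eventuallyEq_const_of_norm_le hmero (M := max M 0) fun z => by
    rw [Pi.div_apply, norm_div]
    exact div_le_of_le_mul₀ (norm_nonneg _) (le_max_right _ _)
      ((h z).trans (by gcongr; exact le_max_left _ _))
  refine ⟨c, fun x => tendsto_nhds_unique_of_eventuallyEq
    ((hN.continuous.tendsto x).mono_left (nhdsWithin_le_nhds (s := {x}ᶜ)))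
    (((hD.continuous.const_mul c).tendsto x).mono_left nhdsWithin_le_nhds) ?_⟩
  filter_upwards [hc x] with z hz
  rcases eq_or_ne (D z) 0 with hDz | hDz
  · simpa [hDz] using h z
  · rw [← hz, Pi.div_apply, div_mul_cancel₀ _ hDz]

theorem exists_basis_of_im_div_ne_zero {a b : ℂ} (hab : (a / b).im ≠ 0) :
    ∃ B : Module.Basis (Fin 2) ℝ ℂ, ⇑B = ![a, b] := by
  have hb : b ≠ 0 := by rintro rfl; simp at hab
  have hli : LinearIndependent ℝ ![a, b] := by
    rw [LinearIndependent.pair_iff]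
    intro s t h
    have h' : s * (a / b) + t = 0 := by
      field_simp
      simpa [mul_comm b] using h
    have hs : s = 0 := by simpa [hab] using congrArg Complex.im h'
    exact ⟨hs, by simpa [hs] using congrArg Complex.re h'⟩
  exact ⟨basisOfLinearIndependentOfCardEqFinrank hli (by simp),
    coe_basisOfLinearIndependentOfCardEqFinrank hli _⟩

theorem exists_eq_const_mul_of_periodic {N D : ℂ → ℂ} (hN : Differentiable ℂ N)
    (hD : Differentiable ℂ D) {s : Set ℂ} (hs : s.Countable) {a b : ℂ} (ha : a ∈ s) (hb : b ∈ s)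
    (hab : (a / b).im ≠ 0) (hD0 : ∀ z ∉ AddSubgroup.closure s, D z ≠ 0)
    {p : ℂ} (hp : p ∈ AddSubgroup.closure s) (hDp : D p ≠ 0)
    (hper : ∀ w ∈ s, ∀ z ∉ AddSubgroup.closure s, ‖N (z + w) / D (z + w)‖ = ‖N z / D z‖) :
    ∃ c, ∀ z, N z = c * D z := by
  obtain ⟨B, hB⟩ := exists_basis_of_im_div_ne_zero hab
  have hcov : ∀ z, ∃ w ∈ AddSubgroup.closure s, z + w ∈ Metric.closedBall 0 (∑ i, ‖B i‖) := by
    intro z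
    refine ⟨-ZSpan.floor B z, neg_mem ?_, ?_⟩
    · have hle : Set.range B ⊆ s := by rw [hB]; simp [Set.insert_subset_iff, ha, hb]
      have h := (ZSpan.floor B z).2
      rw [← Submodule.mem_toAddSubgroup, Submodule.span_int_eq_addSubgroupClosure] at h
      exact AddSubgroup.closure_mono hle h
    · rw [mem_closedBall_zero_iff, ← sub_eq_add_neg, ← ZSpan.fract_apply]
      exact ZSpan.norm_fract_le B z
  obtain ⟨M, hM⟩ := exists_norm_le_mul_norm_of_periodic hN.continuous hD.continuous
    ((countable_addSubgroupClosure hs).dense_compl ℂ) (isCompact_closedBall _ _) hcov hD0 hp hDp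
    (fun w hw => apply_add_eq_of_mem_closure (f := fun z => ‖N z / D z‖) hper hw)
  exact exists_eq_const_mul_of_norm_le hN hD hM

theorem exists_eq_const_mul_of_periodic_of_zero {N D : ℂ → ℂ} (hN : Differentiable ℂ N)
    (hD : Differentiable ℂ D) {s : Set ℂ} (hs : s.Countable) {a b : ℂ} (ha : a ∈ s) (hb : b ∈ s)
    (hab : (a / b).im ≠ 0) (hD0 : ∀ z ∉ AddSubgroup.closure s, D z ≠ 0)
    (hN_zero : N 0 = 0) (hD_zero : D 0 = 0) (hD_deriv : deriv D 0 ≠ 0)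
    (hper : ∀ w ∈ s, ∀ z ∉ AddSubgroup.closure s, ‖N (z + w) / D (z + w)‖ = ‖N z / D z‖) :
    ∃ c, ∀ z, N z = c * D z := by
  have hdslope {f : ℂ → ℂ} (hf : Differentiable ℂ f) : Differentiable ℂ (dslope f 0) :=
    differentiableOn_univ.1
      ((Complex.differentiableOn_dslope univ_mem).2 hf.differentiableOn)
  have hne {z : ℂ} (hz : z ∉ AddSubgroup.closure s) : z ≠ 0 := by
    rintro rfl; exact hz (zero_mem _)
  have hdiv {z : ℂ} (hz : z ≠ 0) : dslope N 0 z / dslope D 0 z = N z / D z := by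
    rw [dslope_of_ne _ hz, dslope_of_ne _ hz, slope_def_field, slope_def_field, hN_zero, hD_zero,
      sub_zero, sub_zero, sub_zero, div_div_div_cancel_right₀ hz]
  obtain ⟨c, hc⟩ := exists_eq_const_mul_of_periodic (hdslope hN) (hdslope hD) hs ha hb hab
    (fun z hz => by
      rw [dslope_of_ne _ (hne hz), slope_def_field, hD_zero, sub_zero, sub_zero]
      exact div_ne_zero (hD0 z hz) (hne hz))
    (zero_mem _) (by rwa [dslope_same]) (fun w hw z hz => by
      have hzw : z + w ∉ AddSubgroup.closure s := by
        rwa [add_mem_cancel_right (AddSubgroup.mem_closure_of_mem hw)]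
      rw [hdiv (hne hz), hdiv (hne hzw), hper w hw z hz])
  refine ⟨c, fun z => ?_⟩
  have hNz := sub_smul_dslope N 0 z
  have hDz := sub_smul_dslope D 0 z
  rw [hN_zero, sub_zero, sub_zero, smul_eq_mul] at hNz
  rw [hD_zero, sub_zero, sub_zero, smul_eq_mul] at hDz
  rw [← hNz, ← hDz, hc, mul_left_comm]

/-! ### The theta function and its modular transformation -/

/-- The theta function `(x; r) (r / x; r)`, where `x = e z`, `r = e σ`, for non-real `σ`; it is the
multiplier of the elliptic gamma function under `z ↦ z + τ`. -/
noncomputable def theta (z σ : ℂ) : ℂ := symb (e z) 0 (e σ) * symb (e (σ - z)) 0 (e σ)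

theorem theta_add_one (z σ : ℂ) : theta (z + 1) σ = theta z σ := by
  rw [theta, theta, e_add_one, e_sub, e_add_one, ← e_sub]

theorem theta_neg_neg (z : ℂ) {σ : ℂ} (hσ : σ.im ≠ 0) : theta (-z) (-σ) = (theta z σ)⁻¹ := by
  rw [theta, theta, e_neg σ, symb_inv_right _ _ (e_ne_zero σ) (norm_e_ne_one hσ),
    symb_inv_right _ _ (e_ne_zero σ) (norm_e_ne_one hσ), ← e_add, ← e_add, mul_inv_rev]
  ring_nf

theorem symb_e_zero_ne_zero {z σ : ℂ} (hσ : σ.im ≠ 0) (hz : z ∉ AddSubgroup.closure {1, σ}) :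
    symb (e z) 0 (e σ) ≠ 0 := by
  refine symb_zero_left_ne_zero (norm_e_ne_one hσ) fun k => ?_
  simpa using e_mul_zpow_mul_zpow_ne_one (τ := σ) (by simpa using hz) 0 k

theorem theta_ne_zero {z σ : ℂ} (hσ : σ.im ≠ 0) (hz : z ∉ AddSubgroup.closure {1, σ}) :
    theta z σ ≠ 0 :=
  mul_ne_zero (symb_e_zero_ne_zero hσ hz) (symb_e_zero_ne_zero hσ
    ((sub_mem_iff_of_mem (AddSubgroup.mem_closure_of_mem (by simp))).not.2 hz))

theorem Gam_add_eq_theta_mul {z τ σ : ℂ} (hτ : τ.im ≠ 0) (hσ : σ.im ≠ 0)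
    (hz : z ∉ AddSubgroup.closure {1, σ}) : Gam (z + τ) τ σ = theta z σ * Gam z τ σ := by
  have hz' : σ - z ∉ AddSubgroup.closure {1, σ} :=
    (sub_mem_iff_of_mem (AddSubgroup.mem_closure_of_mem (by simp))).not.2 hz
  have h1 := symb_e_zero_ne_zero hσ hz
  have hnum := symb_eq_mul_left (norm_e_ne_one hτ) (norm_e_ne_one hσ) (symb_e_zero_ne_zero hσ hz')
  have hden := symb_eq_mul_left (norm_e_ne_one hτ) (norm_e_ne_one hσ) h1
  rw [← e_add] at hnum hden
  rw [Gam_eq, Gam_eq, theta, hden, show τ + σ - (z + τ) = σ - z by ring, hnum, add_comm z τ,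
    add_sub_assoc, div_eq_mul_inv, div_eq_mul_inv, mul_inv]
  field_simp

theorem theta_of_im_pos (z : ℂ) {σ : ℂ} (hσ : 0 < σ.im) :
    theta z σ = doubleProd (e z) 0 (e σ) * doubleProd (e (σ - z)) 0 (e σ) := by
  have h0 : ‖(0 : ℂ)‖ < 1 := by simp
  rw [theta, symb_of_norm_lt_one _ h0 (norm_e_lt_one_iff.2 hσ),
    symb_of_norm_lt_one _ h0 (norm_e_lt_one_iff.2 hσ)]

theorem differentiable_theta {σ : ℂ} (hσ : 0 < σ.im) : Differentiable ℂ fun z => theta z σ := by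
  have h : Differentiable ℂ fun x => doubleProd x 0 (e σ) :=
    differentiable_doubleProd (by simp) (norm_e_lt_one_iff.2 hσ)
  simp_rw [theta_of_im_pos _ hσ]
  exact (h.comp differentiable_e).mul (h.comp (differentiable_e.comp (by fun_prop)))

theorem theta_eq_one_sub_mul (z : ℂ) {σ : ℂ} (hσ : 0 < σ.im) :
    theta z σ = (1 - e z) * (doubleProd (e (σ + z)) 0 (e σ) * doubleProd (e (σ - z)) 0 (e σ)) := by
  rw [theta_of_im_pos _ hσ, doubleProd_zero_eq_one_sub_mul (norm_e_lt_one_iff.2 hσ), e_add,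
    mul_assoc]

theorem theta_zero_left {σ : ℂ} (hσ : 0 < σ.im) : theta 0 σ = 0 := by
  rw [theta_eq_one_sub_mul _ hσ, e_zero, sub_self, zero_mul]

theorem deriv_theta_zero_ne_zero {σ : ℂ} (hσ : 0 < σ.im) : deriv (fun z => theta z σ) 0 ≠ 0 := by
  have hr := norm_e_lt_one_iff.2 hσ
  have h0 : doubleProd (e σ) 0 (e σ) ≠ 0 := doubleProd_ne_zero_of_norm_lt_one (by simp) hr hr
  have hd : Differentiable ℂ fun x => doubleProd x 0 (e σ) := differentiable_doubleProd (by simp) hr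
  have hφ : Differentiable ℂ fun z =>
      doubleProd (e (σ + z)) 0 (e σ) * doubleProd (e (σ - z)) 0 (e σ) :=
    (hd.comp (differentiable_e.comp (by fun_prop))).mul
      (hd.comp (differentiable_e.comp (by fun_prop)))
  have he : HasDerivAt (fun z => 1 - e z) (-(2 * Real.pi * Complex.I)) 0 := by
    simpa [e] using (((hasDerivAt_id (0 : ℂ)).const_mul (2 * Real.pi * Complex.I)).cexp.const_sub 1)
  simp_rw [theta_eq_one_sub_mul _ hσ]
  rw [(he.fun_mul (hφ 0).hasDerivAt).deriv, e_zero, add_zero, sub_zero, sub_self, zero_mul,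
    add_zero]
  exact mul_ne_zero (neg_ne_zero.2 Complex.two_pi_I_ne_zero) (mul_ne_zero h0 h0)

theorem theta_add (z : ℂ) {σ : ℂ} (hσ : 0 < σ.im) : theta (z + σ) σ = -e (-z) * theta z σ := by
  have hr := norm_e_lt_one_iff.2 hσ
  rw [theta_of_im_pos _ hσ, theta_of_im_pos _ hσ, doubleProd_zero_eq_one_sub_mul hr (e z),
    sub_add_cancel_right, doubleProd_zero_eq_one_sub_mul hr (e (-z)), ← e_add, ← e_add,
    ← sub_eq_add_neg, add_comm σ z]
  have h : e (-z) * e z = 1 := by rw [← e_add, neg_add_cancel, e_zero]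
  linear_combination (-doubleProd (e (z + σ)) 0 (e σ) * doubleProd (e (σ - z)) 0 (e σ)) * h

theorem e_add_half (z : ℂ) : e (z + 1 / 2) = -e z := by
  rw [e, mul_add, Complex.exp_add, ← e, mul_one_div, mul_assoc,
    mul_div_cancel_left₀ _ two_ne_zero, Complex.exp_pi_mul_I, mul_neg_one]

theorem e_sub_half (z : ℂ) : e (z - 1 / 2) = -e z := by
  rw [← e_add_half, ← e_add_one]; ring_nf

theorem theta_duplication (z : ℂ) {σ : ℂ} (hσ : 0 < σ.im) :
    theta z σ * theta (z + 1 / 2) σ * (theta (z + σ / 2) σ * theta (z + σ / 2 + 1 / 2) σ) =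
      theta (2 * z) σ := by
  have hs : ‖e (σ / 2)‖ < 1 := norm_e_lt_one_iff.2 (by simpa using hσ)
  have hsq : e σ = e (σ / 2) ^ 2 := by rw [← e_two_mul, mul_div_cancel₀ _ two_ne_zero]
  have hz := doubleProd_zero_duplication hs (e z)
  have hz' := doubleProd_zero_duplication hs (e (σ / 2 - z))
  rw [← hsq, ← e_add, ← e_two_mul] at hz hz'
  simp only [theta_of_im_pos _ hσ, ← sub_sub, e_add_half, e_sub_half]
  rw [show σ - 2 * z = 2 * (σ / 2 - z) by ring, ← hz, ← hz',
    show σ - z - σ / 2 = σ / 2 - z by ring, show σ / 2 + (σ / 2 - z) = σ - z by ring,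
    add_comm z (σ / 2)]
  ring

/-- The Bernoulli polynomial `B_{2,2}(z | a, b)`, whose exponential compensates the multipliers of
`theta` under `a` and `b`. -/
noncomputable def B22 (z a b : ℂ) : ℂ :=
  z ^ 2 / (a * b) - z * (a + b) / (a * b) + (a ^ 2 + b ^ 2 + 3 * a * b) / (6 * a * b)

theorem B22_comm (z a b : ℂ) : B22 z a b = B22 z b a := by
  unfold B22; ring

theorem exp_B22_add_left (z : ℂ) {a b : ℂ} (ha : a ≠ 0) (hb : b ≠ 0) :
    Complex.exp (Complex.I * Real.pi * B22 (z + a) a b) =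
      -e (z / b) * Complex.exp (Complex.I * Real.pi * B22 z a b) := by
  rw [← e_sub_half, e, ← Complex.exp_add]
  congr 1
  unfold B22
  field_simp
  ring

theorem exp_B22_add_right (z : ℂ) {a b : ℂ} (ha : a ≠ 0) (hb : b ≠ 0) :
    Complex.exp (Complex.I * Real.pi * B22 (z + b) a b) =
      -e (z / a) * Complex.exp (Complex.I * Real.pi * B22 z a b) := by
  rw [B22_comm, exp_B22_add_left z hb ha, B22_comm]

theorem exp_B22_duplication (z : ℂ) {a b : ℂ} (ha : a ≠ 0) (hb : b ≠ 0) :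
    Complex.exp (Complex.I * Real.pi * B22 z a b) *
        Complex.exp (Complex.I * Real.pi * B22 (z + b / 2) a b) *
        (Complex.exp (Complex.I * Real.pi * B22 (z + a / 2) a b) *
          Complex.exp (Complex.I * Real.pi * B22 (z + a / 2 + b / 2) a b)) =
      Complex.exp (Complex.I * Real.pi * B22 (2 * z) a b) := by
  rw [← Complex.exp_add, ← Complex.exp_add, ← Complex.exp_add]
  congr 1
  unfold B22
  field_simp
  ring

theorem im_div_ne_zero_symm {a b : ℂ} (h : (a / b).im ≠ 0) : (b / a).im ≠ 0 := by
  have h0 : a / b ≠ 0 := by rintro h'; simp [h'] at h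
  rw [← inv_div, Complex.inv_im]
  exact div_ne_zero (neg_ne_zero.2 h) (Complex.normSq_pos.2 h0).ne'

theorem im_div_mul_im_div_neg {a b : ℂ} (h : (a / b).im ≠ 0) : (a / b).im * (b / a).im < 0 := by
  have h0 : a / b ≠ 0 := by rintro h'; simp [h'] at h
  rw [← inv_div a b, Complex.inv_im, mul_div_assoc', mul_neg]
  exact div_neg_of_neg_of_pos (neg_neg_of_pos (mul_self_pos.2 h)) (Complex.normSq_pos.2 h0)

/-- The theta function with periods `a` and `b`, normalised by a Gaussian factor: it is invariant
under `z ↦ z + a`, and its quasi-period under `z ↦ z + b` is the one of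
`theta (-z / a) (-b / a)`. -/
noncomputable def gaussTheta (z a b : ℂ) : ℂ :=
  theta (z / b) (a / b) * Complex.exp (Complex.I * Real.pi * B22 z a b)

theorem differentiable_gaussTheta {a b : ℂ} (hab : 0 < (a / b).im) :
    Differentiable ℂ fun z => gaussTheta z a b := by
  refine ((differentiable_theta hab).comp (by fun_prop)).mul (Differentiable.cexp ?_)
  unfold B22; fun_prop

theorem gaussTheta_add_left (z : ℂ) {a b : ℂ} (hab : 0 < (a / b).im) :
    gaussTheta (z + a) a b = gaussTheta z a b := by
  have ha : a ≠ 0 := by rintro rfl; simp at hab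
  have hb : b ≠ 0 := by rintro rfl; simp at hab
  have h : e (-(z / b)) * e (z / b) = 1 := by rw [← e_add, neg_add_cancel, e_zero]
  rw [gaussTheta, gaussTheta, add_div, theta_add _ hab, exp_B22_add_left z ha hb]
  linear_combination (theta (z / b) (a / b) * Complex.exp (Complex.I * Real.pi * B22 z a b)) * h

theorem gaussTheta_add_right (z : ℂ) {a b : ℂ} (ha : a ≠ 0) (hb : b ≠ 0) :
    gaussTheta (z + b) a b = -e (z / a) * gaussTheta z a b := by
  rw [gaussTheta, gaussTheta, add_div, div_self hb, theta_add_one, exp_B22_add_right z ha hb,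
    mul_left_comm]

theorem gaussTheta_duplication (z : ℂ) {a b : ℂ} (hab : 0 < (a / b).im) :
    gaussTheta z a b * gaussTheta (z + b / 2) a b *
        (gaussTheta (z + a / 2) a b * gaussTheta (z + a / 2 + b / 2) a b) =
      gaussTheta (2 * z) a b := by
  have ha : a ≠ 0 := by rintro rfl; simp at hab
  have hb : b ≠ 0 := by rintro rfl; simp at hab
  have hhalf : b / 2 / b = 1 / 2 := by field_simp
  have h := theta_duplication (z / b) hab
  simp only [gaussTheta, add_div, hhalf, mul_div_assoc 2 z, ← h, ← exp_B22_duplication z ha hb,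
    div_right_comm a 2 b]
  ring

theorem theta_neg_div_add_left (z σ : ℂ) {a : ℂ} (ha : a ≠ 0) :
    theta (-(z + a) / a) σ = theta (-z / a) σ := by
  rw [← theta_add_one, neg_add, add_div, neg_div_self ha, neg_add_cancel_right]

theorem theta_neg_div_add_right (z : ℂ) {a b : ℂ} (hba : 0 < (-b / a).im) :
    theta (-(z + b) / a) (-b / a) = -e (z / a) * theta (-z / a) (-b / a) := by
  rw [neg_add, add_div, theta_add _ hba, ← neg_div, neg_neg]

theorem theta_neg_div_duplication (z : ℂ) {a b : ℂ} (ha : a ≠ 0) (hba : 0 < (-b / a).im) :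
    theta (-z / a) (-b / a) * theta (-(z + b / 2) / a) (-b / a) *
        (theta (-(z + a / 2) / a) (-b / a) * theta (-(z + a / 2 + b / 2) / a) (-b / a)) =
      theta (-(2 * z) / a) (-b / a) := by
  rw [show -(2 * z) / a = 2 * (-z / a) by ring, ← theta_duplication _ hba,
    ← theta_add_one (-(z + a / 2) / a), ← theta_add_one (-(z + a / 2 + b / 2) / a),
    show -(z + b / 2) / a = -z / a + -b / a / 2 by ring,
    show -(z + a / 2) / a + 1 = -z / a + 1 / 2 by field_simp; ring,
    show -(z + a / 2 + b / 2) / a + 1 = -z / a + -b / a / 2 + 1 / 2 by field_simp; ring]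
  ring

theorem theta_div_ne_zero {z a b : ℂ} (hab : (a / b).im ≠ 0)
    (hz : z ∉ AddSubgroup.closure {a, b}) : theta (z / b) (a / b) ≠ 0 := by
  have hb : b ≠ 0 := by rintro rfl; simp at hab
  refine theta_ne_zero hab (div_notMem_addSubgroupClosure hb (fun w hw => ?_) hz)
  apply AddSubgroup.subset_closure
  rcases hw with rfl | rfl <;> simp [mul_div_cancel₀ _ hb]

theorem theta_neg_div_ne_zero {z a b : ℂ} (hab : (a / b).im ≠ 0)
    (hz : z ∉ AddSubgroup.closure {a, b}) : theta (-z / a) (-b / a) ≠ 0 := by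
  have hba := im_div_ne_zero_symm hab
  rw [Set.pair_comm] at hz
  rw [neg_div, neg_div, theta_neg_neg _ hba]
  exact inv_ne_zero (theta_div_ne_zero hba hz)

theorem exists_gaussTheta_eq_const_mul {a b : ℂ} (hab : 0 < (a / b).im) :
    ∃ c, ∀ z, gaussTheta z a b = c * theta (-z / a) (-b / a) := by
  have ha : a ≠ 0 := by rintro rfl; simp at hab
  have hb : b ≠ 0 := by rintro rfl; simp at hab
  have hba : 0 < (-b / a).im := by
    rw [neg_div, Complex.neg_im, neg_pos]
    exact neg_of_mul_neg_right (im_div_mul_im_div_neg hab.ne') hab.le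
  refine exists_eq_const_mul_of_periodic_of_zero (s := {a, b}) (differentiable_gaussTheta hab)
    ((differentiable_theta hba).comp (by fun_prop)) (Set.toFinite _).countable (by simp) (by simp)
    hab.ne' (fun z => theta_neg_div_ne_zero hab.ne') ?_ ?_ ?_ ?_
  · rw [gaussTheta, zero_div, theta_zero_left hab, zero_mul]
  · rw [neg_zero, zero_div, theta_zero_left hba]
  · have h := deriv_comp_mul_left (-a⁻¹) (fun z => theta z (-b / a)) 0
    rw [mul_zero] at h
    convert smul_ne_zero (neg_ne_zero.2 (inv_ne_zero ha)) (deriv_theta_zero_ne_zero hba) using 1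
    rw [← h]
    congr 1
    ext z
    rw [div_eq_inv_mul, mul_neg, neg_mul]
  · rintro w (rfl | rfl) z -
    · simp only [gaussTheta_add_left z hab, theta_neg_div_add_left z _ ha]
    · simp only [gaussTheta_add_right z ha hb, theta_neg_div_add_right z hba]
      rw [mul_div_mul_left _ _ (neg_ne_zero.2 (e_ne_zero _))]

theorem pow_three_eq_one_of_gaussTheta_eq {a b c : ℂ} (hab : 0 < (a / b).im)
    (hc : ∀ z, gaussTheta z a b = c * theta (-z / a) (-b / a)) : c ^ 3 = 1 := by
  have ha : a ≠ 0 := by rintro rfl; simp at hab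
  have hba : 0 < (-b / a).im := by
    rw [neg_div, Complex.neg_im, neg_pos]
    exact neg_of_mul_neg_right (im_div_mul_im_div_neg hab.ne') hab.le
  obtain ⟨w, hw⟩ := ((countable_addSubgroupClosure (s := {a, b})
    (Set.toFinite _).countable).dense_compl ℂ).nonempty
  obtain ⟨z, rfl⟩ : ∃ z, w = 2 * z := ⟨w / 2, by ring⟩
  have hgauss : gaussTheta (2 * z) a b ≠ 0 :=
    mul_ne_zero (theta_div_ne_zero hab.ne' hw) (Complex.exp_ne_zero _)
  have h := gaussTheta_duplication z hab
  simp only [hc] at h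
  rw [← theta_neg_div_duplication z ha hba] at h
  rw [hc, ← theta_neg_div_duplication z ha hba] at hgauss
  exact mul_left_cancel₀ hgauss (by linear_combination h)

theorem exists_theta_mul_theta {a b : ℂ} (hab : (a / b).im ≠ 0) :
    ∃ c : ℂ, c ^ 3 = 1 ∧ ∀ z ∉ AddSubgroup.closure {a, b},
      theta (z / b) (a / b) * theta (z / a) (b / a) *
        Complex.exp (Complex.I * Real.pi * B22 z a b) = c := by
  wlog hpos : 0 < (a / b).im generalizing a b
  · have hneg := lt_of_le_of_ne (not_lt.1 hpos) hab
    obtain ⟨c, hc3, hc⟩ := this (im_div_ne_zero_symm hab)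
      (pos_of_mul_neg_right (im_div_mul_im_div_neg hab) hneg.le)
    refine ⟨c, hc3, fun z hz => ?_⟩
    rw [← hc z (by rwa [Set.pair_comm]), B22_comm, mul_comm (theta _ _)]
  obtain ⟨c, hc⟩ := exists_gaussTheta_eq_const_mul hpos
  refine ⟨c, pow_three_eq_one_of_gaussTheta_eq hpos hc, fun z hz => ?_⟩
  have hba := im_div_ne_zero_symm hab
  have hinv : theta (-z / a) (-b / a) = (theta (z / a) (b / a))⁻¹ := by
    rw [neg_div, neg_div, theta_neg_neg _ hba]
  have hne : theta (z / a) (b / a) ≠ 0 := theta_div_ne_zero hba (by rwa [Set.pair_comm])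
  rw [mul_right_comm, ← gaussTheta, hc, hinv, inv_mul_cancel_right₀ hne]

/-! ### The modular product of three elliptic gamma functions -/

theorem abs_add_lt_of_mul_neg {x y : ℝ} (h : x * y < 0) : |x + y| < |x| + |y| := by
  rcases mul_neg_iff.1 h with ⟨hx, hy⟩ | ⟨hx, hy⟩
  · rw [abs_of_pos hx, abs_of_neg hy, abs_lt]; constructor <;> linarith
  · rw [abs_of_neg hx, abs_of_pos hy, abs_lt]; constructor <;> linarith

theorem mem_strip_of_im_eq_zero {z τ σ : ℂ} (hz : z.im = 0) (h : τ.im * σ.im < 0) :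
    z ∈ strip τ σ := by
  have him : (2 * z - τ - σ).im = -(τ.im + σ.im) := by simp [hz]; ring
  rw [strip, Set.mem_ofPred_eq, him, abs_neg]
  exact abs_add_lt_of_mul_neg h

theorem left_mem_strip {τ σ : ℂ} (h : 0 < τ.im * σ.im) : τ ∈ strip τ σ := by
  have him : (2 * τ - τ - σ).im = τ.im + -σ.im := by simp; ring
  rw [strip, Set.mem_ofPred_eq, him, ← abs_neg σ.im]
  exact abs_add_lt_of_mul_neg (by linarith)

theorem right_mem_strip {τ σ : ℂ} (h : 0 < τ.im * σ.im) : σ ∈ strip τ σ :=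
  strip_comm σ τ ▸ left_mem_strip (by rwa [mul_comm])

theorem exists_div_mem_strip {a b c : ℂ} (hab : (a / b).im ≠ 0) (hbc : (b / c).im ≠ 0)
    (hca : (c / a).im ≠ 0) : ∃ p ∈ AddSubgroup.closure {a, b, c},
      p / c ∈ strip (a / c) (b / c) ∧ p / a ∈ strip (b / a) (c / a) ∧
        p / b ∈ strip (c / b) (a / b) := by
  have real {w : ℂ} : (w / w).im = 0 := by rcases eq_or_ne w 0 with rfl | h <;> simp [*]
  have real₀ {w : ℂ} : ((0 : ℂ) / w).im = 0 := by simp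
  have hX : (a / c).im * (b / c).im ≠ 0 := mul_ne_zero (im_div_ne_zero_symm hca) hbc
  have hY : (b / a).im * (c / a).im ≠ 0 := mul_ne_zero (im_div_ne_zero_symm hab) hca
  have hXYZ : (a / c).im * (b / c).im * ((b / a).im * (c / a).im) *
      ((c / b).im * (a / b).im) < 0 := by
    have h := mul_neg_of_pos_of_neg (mul_pos_of_neg_of_neg (im_div_mul_im_div_neg hab)
      (im_div_mul_im_div_neg hbc)) (im_div_mul_im_div_neg hca)
    linarith
  rcases hX.lt_or_gt with hX | hX <;> rcases hY.lt_or_gt with hY | hY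
  · have hZ := neg_of_mul_neg_right hXYZ (mul_pos_of_neg_of_neg hX hY).le
    exact ⟨0, zero_mem _, mem_strip_of_im_eq_zero real₀ hX, mem_strip_of_im_eq_zero real₀ hY,
      mem_strip_of_im_eq_zero real₀ hZ⟩
  · have hZ := pos_of_mul_neg_right hXYZ (mul_neg_of_neg_of_pos hX hY).le
    exact ⟨c, AddSubgroup.mem_closure_of_mem (by simp), mem_strip_of_im_eq_zero real hX,
      right_mem_strip hY, left_mem_strip hZ⟩
  · have hZ := pos_of_mul_neg_right hXYZ (mul_neg_of_pos_of_neg hX hY).le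
    exact ⟨a, AddSubgroup.mem_closure_of_mem (by simp), left_mem_strip hX,
      mem_strip_of_im_eq_zero real hY, right_mem_strip hZ⟩
  · have hZ := neg_of_mul_neg_right hXYZ (mul_pos hX hY).le
    exact ⟨b, AddSubgroup.mem_closure_of_mem (by simp), right_mem_strip hX, left_mem_strip hY,
      mem_strip_of_im_eq_zero real hZ⟩

/-- The Bernoulli polynomial `B_{3,3}(z | a, b, c)`, whose difference quotients are the
polynomials `B22`. -/
noncomputable def B33 (z a b c : ℂ) : ℂ :=
  (z ^ 3 - 3 / 2 * (a + b + c) * z ^ 2 +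
    (a ^ 2 + b ^ 2 + c ^ 2 + 3 * (a * b + b * c + c * a)) / 2 * z -
    (a + b + c) * (a * b + b * c + c * a) / 4) / (a * b * c)

theorem exp_B33_add_left (z : ℂ) {a b c : ℂ} (ha : a ≠ 0) (hb : b ≠ 0) (hc : c ≠ 0) :
    Complex.exp (Complex.I * Real.pi * (B33 (z + a) a b c / 3)) =
      Complex.exp (Complex.I * Real.pi * B22 z b c) *
        Complex.exp (Complex.I * Real.pi * (B33 z a b c / 3)) := by
  rw [← Complex.exp_add]
  congr 1
  unfold B33 B22
  field_simp
  ring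

/-- The homogeneous form of the modular relation: a product, symmetric under rotation of the
periods `a`, `b`, `c`, which turns out to be identically one. -/
noncomputable def modularProduct (z a b c : ℂ) : ℂ :=
  Gam (z / c) (a / c) (b / c) * Gam (z / a) (b / a) (c / a) * Gam (z / b) (c / b) (a / b) *
    Complex.exp (Complex.I * Real.pi * (B33 z a b c / 3))

theorem modularProduct_rotate (z a b c : ℂ) : modularProduct z b c a = modularProduct z a b c := by
  unfold modularProduct B33
  congr 1
  · ring
  · ring_nf

theorem Gam_add_div_eq_theta_mul {z a b c : ℂ} (hac : (a / c).im ≠ 0) (hbc : (b / c).im ≠ 0)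
    (hz : z ∉ AddSubgroup.closure {b, c}) :
    Gam ((z + a) / c) (a / c) (b / c) = theta (z / c) (b / c) * Gam (z / c) (a / c) (b / c) := by
  have hc : c ≠ 0 := by rintro rfl; simp at hbc
  rw [add_div]
  refine Gam_add_eq_theta_mul hac hbc (div_notMem_addSubgroupClosure hc (fun w hw => ?_) hz)
  apply AddSubgroup.subset_closure
  rcases hw with rfl | rfl <;> simp [mul_div_cancel₀ _ hc]

theorem Gam_div_eq_one {z a b c : ℂ} (hac : (a / c).im ≠ 0) (hbc : (b / c).im ≠ 0)
    (hz : 2 * z = a + b + c) : Gam (z / c) (a / c) (b / c) = 1 := by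
  have hc : c ≠ 0 := by rintro rfl; simp at hbc
  refine Gam_eq_one hac hbc ?_
  field_simp
  linear_combination hz

theorem exists_modularProduct_add_left {a b c : ℂ} (hab : (a / b).im ≠ 0) (hbc : (b / c).im ≠ 0)
    (hca : (c / a).im ≠ 0) : ∃ k : ℂ, k ^ 3 = 1 ∧ ∀ z ∉ AddSubgroup.closure {b, c},
      modularProduct (z + a) a b c = k * modularProduct z a b c := by
  have ha : a ≠ 0 := by rintro rfl; simp at hab
  have hb : b ≠ 0 := by rintro rfl; simp at hab
  have hc : c ≠ 0 := by rintro rfl; simp at hbc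
  obtain ⟨k, hk3, hk⟩ := exists_theta_mul_theta hbc
  refine ⟨k, hk3, fun z hz => ?_⟩
  rw [← hk z hz, modularProduct, modularProduct, exp_B33_add_left z ha hb hc, Gam_comm _ (c / b),
    Gam_add_div_eq_theta_mul (im_div_ne_zero_symm hca) hbc hz,
    Gam_add_div_eq_theta_mul hab (im_div_ne_zero_symm hbc) (by rwa [Set.pair_comm]),
    Gam_comm _ (a / b), add_div z a a, div_self ha, Gam_add_one]
  ring

theorem norm_modularProduct_add_left {z a b c : ℂ} (hab : (a / b).im ≠ 0) (hbc : (b / c).im ≠ 0)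
    (hca : (c / a).im ≠ 0) (hz : z ∉ AddSubgroup.closure {a, b, c}) :
    ‖modularProduct (z + a) a b c‖ = ‖modularProduct z a b c‖ := by
  obtain ⟨k, hk3, hk⟩ := exists_modularProduct_add_left hab hbc hca
  rw [hk z fun h => hz (AddSubgroup.closure_mono (Set.subset_insert a {b, c}) h), norm_mul,
    Complex.norm_eq_one_of_pow_eq_one hk3 three_ne_zero, one_mul]

theorem insert_insert_singleton_rotate {α : Type*} (a b c : α) :
    ({b, c, a} : Set α) = {a, b, c} := by
  ext; simp only [Set.mem_insert_iff, Set.mem_singleton_iff]; tauto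

theorem norm_modularProduct_add {z w a b c : ℂ} (hab : (a / b).im ≠ 0) (hbc : (b / c).im ≠ 0)
    (hca : (c / a).im ≠ 0) (hw : w ∈ ({a, b, c} : Set ℂ))
    (hz : z ∉ AddSubgroup.closure {a, b, c}) :
    ‖modularProduct (z + w) a b c‖ = ‖modularProduct z a b c‖ := by
  rcases hw with rfl | rfl | rfl
  · exact norm_modularProduct_add_left hab hbc hca hz
  · have h := norm_modularProduct_add_left hbc hca hab
      ((insert_insert_singleton_rotate a w c).symm ▸ hz)
    rwa [modularProduct_rotate _ a w c, modularProduct_rotate _ a w c] at h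
  · rw [← modularProduct_rotate _ a b w, ← modularProduct_rotate _ a b w,
      ← modularProduct_rotate _ b w a, ← modularProduct_rotate _ b w a]
    rw [← insert_insert_singleton_rotate, ← insert_insert_singleton_rotate] at hz
    exact norm_modularProduct_add_left hca hab hbc hz

theorem exists_modularProduct_eq_div {a b c : ℂ} (hab : (a / b).im ≠ 0) (hbc : (b / c).im ≠ 0)
    (hca : (c / a).im ≠ 0) : ∃ N D : ℂ → ℂ, Differentiable ℂ N ∧ Differentiable ℂ D ∧
      (∀ z, modularProduct z a b c = N z / D z) ∧
      (∀ z ∉ AddSubgroup.closure {a, b, c}, D z ≠ 0) ∧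
      ∃ p ∈ AddSubgroup.closure {a, b, c}, D p ≠ 0 := by
  obtain ⟨N₁, D₁, h₁⟩ := exists_isReducedQuotient (im_div_ne_zero_symm hca) hbc
  obtain ⟨N₂, D₂, h₂⟩ := exists_isReducedQuotient (im_div_ne_zero_symm hab) hca
  obtain ⟨N₃, D₃, h₃⟩ := exists_isReducedQuotient (im_div_ne_zero_symm hbc) hab
  obtain ⟨p, hp, hp₁, hp₂, hp₃⟩ := exists_div_mem_strip hab hbc hca
  have hdiv (d : ℂ) : Differentiable ℂ fun z => z / d := by fun_prop
  refine ⟨fun z => N₁ (z / c) * N₂ (z / a) * N₃ (z / b) *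
      Complex.exp (Complex.I * Real.pi * (B33 z a b c / 3)),
    fun z => D₁ (z / c) * D₂ (z / a) * D₃ (z / b), ?_, ?_, fun z => ?_, fun z hz => ?_,
    p, hp, ?_⟩
  · refine (((h₁.differentiable_num.comp (hdiv c)).mul (h₂.differentiable_num.comp (hdiv a))).mul
      (h₃.differentiable_num.comp (hdiv b))).mul ?_
    unfold B33
    fun_prop
  · exact ((h₁.differentiable_den.comp (hdiv c)).mul (h₂.differentiable_den.comp (hdiv a))).mul
      (h₃.differentiable_den.comp (hdiv b))
  · rw [modularProduct, h₁.Gam_eq_div, h₂.Gam_eq_div, h₃.Gam_eq_div]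
    ring
  · have hden {a b c : ℂ} {N D : ℂ → ℂ} (hac : (a / c).im ≠ 0) (hbc : (b / c).im ≠ 0)
        (h : IsReducedQuotient (a / c) (b / c) N D) (hz : z ∉ AddSubgroup.closure {a, b, c}) :
        D (z / c) ≠ 0 := by
      have hc : c ≠ 0 := by rintro rfl; simp at hbc
      refine (h.ne_zero_of_notMem hac hbc
        (div_notMem_addSubgroupClosure hc (fun w hw => ?_) hz)).2
      apply AddSubgroup.subset_closure
      rcases hw with rfl | rfl | rfl <;> simp [mul_div_cancel₀ _ hc]
    exact mul_ne_zero (mul_ne_zero (hden (im_div_ne_zero_symm hca) hbc h₁ hz)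
      (hden (im_div_ne_zero_symm hab) hca h₂ (insert_insert_singleton_rotate a b c ▸ hz)))
      (hden (im_div_ne_zero_symm hbc) hab h₃ (insert_insert_singleton_rotate c a b ▸ hz))
  · exact mul_ne_zero (mul_ne_zero (h₁.ne_zero_of_mem_strip _ hp₁).2
      (h₂.ne_zero_of_mem_strip _ hp₂).2) (h₃.ne_zero_of_mem_strip _ hp₃).2

theorem modularProduct_center {a b c : ℂ} (hab : (a / b).im ≠ 0) (hbc : (b / c).im ≠ 0)
    (hca : (c / a).im ≠ 0) : modularProduct ((a + b + c) / 2) a b c = 1 := by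
  have hB : B33 ((a + b + c) / 2) a b c = 0 := by unfold B33; ring
  rw [modularProduct, hB, Gam_div_eq_one (im_div_ne_zero_symm hca) hbc (by ring),
    Gam_div_eq_one (im_div_ne_zero_symm hab) hca (by ring),
    Gam_div_eq_one (im_div_ne_zero_symm hbc) hab (by ring)]
  simp

theorem modularProduct_eq_one {z a b c : ℂ} (hab : (a / b).im ≠ 0) (hbc : (b / c).im ≠ 0)
    (hca : (c / a).im ≠ 0) (hz : z ∉ AddSubgroup.closure {a, b, c}) :
    modularProduct z a b c = 1 := by
  obtain ⟨N, D, hN, hD, hND, hD0, p, hp, hDp⟩ := exists_modularProduct_eq_div hab hbc hca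
  obtain ⟨k, hk⟩ := exists_eq_const_mul_of_periodic hN hD (Set.toFinite {a, b, c}).countable
    (by simp) (by simp) hab hD0 hp hDp fun w hw z hz => by
      rw [← hND, ← hND, norm_modularProduct_add hab hbc hca hw hz]
  have hcenter := modularProduct_center hab hbc hca
  rw [hND, hk] at hcenter
  have hD_center : D ((a + b + c) / 2) ≠ 0 := by intro h; simp [h] at hcenter
  rw [mul_div_cancel_right₀ _ hD_center] at hcenter
  rw [hND, hk, hcenter, one_mul, div_self (hD0 z hz)]

theorem Gam_modular_of_notMem {z τ σ : ℂ} (hτ : τ.im ≠ 0) (hσ : σ.im ≠ 0) (hστ : (σ / τ).im ≠ 0)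
    (hz : z ∉ AddSubgroup.closure {1, τ, σ}) :
    Gam (z / σ) (τ / σ) (-1 / σ) = Complex.exp (Complex.I * Real.pi * Q z τ σ) *
      Gam ((z - σ) / τ) (-1 / τ) (-σ / τ) * Gam z τ σ := by
  have hτ0 : τ ≠ 0 := by rintro rfl; simp at hτ
  have hσ0 : σ ≠ 0 := by rintro rfl; simp at hσ
  have h1τ : (1 / τ).im ≠ 0 := im_div_ne_zero_symm (by rwa [div_one])
  have h1σ : (1 / σ).im ≠ 0 := im_div_ne_zero_symm (by rwa [div_one])
  have hone : (1 : ℂ) ∈ AddSubgroup.closure {1, τ, σ} := AddSubgroup.mem_closure_of_mem (by simp)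
  have hprod : modularProduct (z + 1) 1 τ σ = 1 :=
    modularProduct_eq_one h1τ (im_div_ne_zero_symm hστ) (by rwa [div_one])
      (by rwa [add_mem_cancel_right hone])
  have hleft : Gam (z / σ) (τ / σ) (-1 / σ) = (Gam ((z + 1) / σ) (1 / σ) (τ / σ))⁻¹ := by
    rw [neg_div, Gam_neg_right _ _ h1σ, Gam_comm, add_div]
  have hright : Gam ((z - σ) / τ) (-1 / τ) (-σ / τ) = Gam ((z + 1) / τ) (σ / τ) (1 / τ) := by
    rw [neg_div, neg_div, Gam_neg_left _ _ h1τ, Gam_neg_right _ _ hστ, inv_inv, Gam_comm]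
    ring_nf
  have hQ : B33 (z + 1) 1 τ σ / 3 = Q z τ σ := by
    unfold Q B33; field_simp; ring
  rw [modularProduct, hQ, div_one, div_one, div_one, Gam_add_one] at hprod
  rw [hleft, hright]
  exact inv_eq_of_mul_eq_one_right (by linear_combination hprod)

/-! ### The additive relation -/

theorem Gam_eq_mul_of_im_pos {τ σ : ℂ} (hτ : 0 < τ.im) (hσ : 0 < σ.im) (z : ℂ) :
    Gam z τ σ = Gam z (τ + σ) σ * Gam (z + τ) τ (σ + τ) := by
  have hq := norm_e_lt_one_iff.2 hτ
  have hr := norm_e_lt_one_iff.2 hσ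
  have hqr : ‖e (τ + σ)‖ < 1 := norm_e_lt_one_iff.2 (by rw [Complex.add_im]; positivity)
  have hnum := doubleProd_add hr hq (e (τ + σ - z))
  have hden := doubleProd_add hq hr (e z)
  rw [← e_add, ← e_add] at hnum hden
  rw [add_comm σ τ, Gam_eq, Gam_eq, Gam_eq, symb_of_norm_lt_one _ hq hr,
    symb_of_norm_lt_one _ hq hr, symb_of_norm_lt_one _ hqr hr, symb_of_norm_lt_one _ hqr hr,
    symb_of_norm_lt_one _ hq hqr, symb_of_norm_lt_one _ hq hqr, doubleProd_comm _ (e τ) (e σ),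
    hnum, hden, add_comm σ τ, doubleProd_comm _ (e (τ + σ)) (e τ), doubleProd_comm _ (e σ)]
  ring_nf

theorem addSubgroupClosure_one_add_le (τ σ : ℂ) :
    AddSubgroup.closure {1, τ + σ, σ} ≤ AddSubgroup.closure {1, τ, σ} := by
  have hτ : τ ∈ AddSubgroup.closure {1, τ, σ} := AddSubgroup.mem_closure_of_mem (by simp)
  have hσ : σ ∈ AddSubgroup.closure {1, τ, σ} := AddSubgroup.mem_closure_of_mem (by simp)
  rw [AddSubgroup.closure_le]
  rintro w (rfl | rfl | rfl)
  exacts [AddSubgroup.mem_closure_of_mem (by simp), add_mem hτ hσ, hσ]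

theorem Gam_add_left_ne_zero {z τ σ : ℂ} (hσ : σ.im ≠ 0) (hadd : (τ + σ).im ≠ 0)
    (hz : z ∉ AddSubgroup.closure {1, τ, σ}) : Gam z (τ + σ) σ ≠ 0 :=
  Gam_ne_zero hadd hσ fun h => hz (addSubgroupClosure_one_add_le τ σ h)

theorem Gam_add_ne_zero {z τ σ : ℂ} (hτ : τ.im ≠ 0) (hadd : (τ + σ).im ≠ 0)
    (hz : z ∉ AddSubgroup.closure {1, τ, σ}) : Gam (z + τ) τ (σ + τ) ≠ 0 := by
  have hτmem : τ ∈ AddSubgroup.closure {1, τ, σ} := AddSubgroup.mem_closure_of_mem (by simp)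
  rw [Gam_comm]
  refine Gam_add_left_ne_zero hτ (by rwa [add_comm]) ?_
  rwa [Set.pair_comm, add_mem_cancel_right hτmem]

theorem Gam_eq_mul_of_im_add_pos {z τ σ : ℂ} (hτ : τ.im ≠ 0) (hσ : σ.im ≠ 0)
    (hadd : 0 < (τ + σ).im) (hz : z ∉ AddSubgroup.closure {1, τ, σ}) :
    Gam z τ σ = Gam z (τ + σ) σ * Gam (z + τ) τ (σ + τ) := by
  have h₁ : Gam z τ σ ≠ 0 := Gam_ne_zero hτ hσ hz
  have h₂ : Gam z (τ + σ) σ ≠ 0 := Gam_add_left_ne_zero hσ hadd.ne' hz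
  have h₃ : Gam (z + τ) τ (σ + τ) ≠ 0 := Gam_add_ne_zero hτ hadd.ne' hz
  rw [add_comm σ τ] at h₃ ⊢
  rcases hτ.lt_or_gt with hτ' | hτ'
  · have h := Gam_eq_mul_of_im_pos (τ := -τ) (by simpa using hτ') hadd z
    rw [Gam_neg_left _ _ hτ, neg_add_cancel_left, Gam_neg_left _ _ hτ, add_neg_cancel_comm,
      neg_add_cancel_right, Gam_comm _ σ] at h
    field_simp at h
    linear_combination h
  rcases hσ.lt_or_gt with hσ' | hσ'
  · have h := Gam_eq_mul_of_im_pos (σ := -σ) hadd (by simpa using hσ') (z - σ)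
    rw [Gam_neg_right _ _ hσ, add_neg_cancel_right, Gam_neg_right _ _ hσ, sub_add_cancel,
      neg_add_cancel_comm_assoc, show z - σ + (τ + σ) = z + τ by ring,
      Gam_comm (z + τ) (τ + σ)] at h
    field_simp at h
    linear_combination h
  · rw [add_comm τ σ, Gam_eq_mul_of_im_pos hτ' hσ' z, add_comm σ τ]

theorem Gam_eq_mul_of_notMem {z τ σ : ℂ} (hτ : τ.im ≠ 0) (hσ : σ.im ≠ 0) (hadd : (τ + σ).im ≠ 0)
    (hz : z ∉ AddSubgroup.closure {1, τ, σ}) :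
    Gam z τ σ = Gam z (τ + σ) σ * Gam (z + τ) τ (σ + τ) := by
  rcases hadd.lt_or_gt with h | h
  · have hneg : -z ∉ AddSubgroup.closure {1, -τ, -σ} := by
      have hle : AddSubgroup.closure {1, -τ, -σ} ≤ AddSubgroup.closure {1, τ, σ} := by
        rw [AddSubgroup.closure_le]
        rintro w (rfl | rfl | rfl)
        · exact AddSubgroup.mem_closure_of_mem (by simp)
        all_goals exact neg_mem (AddSubgroup.mem_closure_of_mem (by simp))
      exact fun hmem => hz (neg_mem_iff.1 (hle hmem))
    have hinv := Gam_eq_mul_of_im_add_pos (τ := -τ) (σ := -σ) (by simpa using hτ)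
      (by simpa using hσ) (by rw [← neg_add, Complex.neg_im]; linarith) hneg
    rw [← neg_add, ← neg_add, ← neg_add, Gam_neg_neg _ hτ hσ, Gam_neg_neg _ hadd hσ,
      Gam_neg_neg _ hτ (by rwa [add_comm]), ← mul_inv] at hinv
    exact inv_injective hinv
  · exact Gam_eq_mul_of_im_add_pos hτ hσ h hz

/-! ### From generic points to meromorphic functions and to values -/

theorem meromorphic_Gam_comp {τ σ : ℂ} (hτ : τ.im ≠ 0) (hσ : σ.im ≠ 0) {g : ℂ → ℂ}
    (hg : Differentiable ℂ g) : Meromorphic fun z => Gam (g z) τ σ := by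
  obtain ⟨N, D, h⟩ := exists_isReducedQuotient hτ hσ
  intro z
  simp only [h.Gam_eq_div]
  exact ((h.differentiable_num.comp hg).analyticAt z).meromorphicAt.div
    ((h.differentiable_den.comp hg).analyticAt z).meromorphicAt

theorem frequently_notMem_nhdsNE {S : Set ℂ} (hS : S.Countable) (x : ℂ) :
    ∃ᶠ z in 𝓝[≠] x, z ∉ S := by
  have hdense : Dense (S ∪ {x})ᶜ := (hS.union (Set.countable_singleton x)).dense_compl ℂ
  rw [frequently_nhdsWithin_iff]
  refine (mem_closure_iff_frequently.1 (hdense x)).mono fun z hz => ?_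
  rwa [Set.compl_union] at hz

theorem eventuallyEq_codiscrete_of_countable {f g : ℂ → ℂ} (hf : Meromorphic f)
    (hg : Meromorphic g) {S : Set ℂ} (hS : S.Countable) (h : ∀ z ∉ S, f z = g z) :
    f =ᶠ[codiscrete ℂ] g := by
  rw [EventuallyEq, Filter.Eventually, mem_codiscrete]
  intro x
  rw [disjoint_principal_right, compl_compl]
  rcases ((hf x).sub (hg x)).eventually_eq_zero_or_eventually_ne_zero with h0 | h0
  · filter_upwards [h0] with z hz using sub_eq_zero.1 hz
  · obtain ⟨z, hz, hz'⟩ := ((frequently_notMem_nhdsNE hS x).and_eventually h0).exists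
    exact absurd (sub_eq_zero.2 (h z hz)) hz'

theorem IsReducedQuotient.den_ne_zero_of_num_eq {τ σ z c : ℂ} {N D : ℂ → ℂ}
    (h : IsReducedQuotient τ σ N D) (hN : N z = c * D z) : D z ≠ 0 := by
  intro hD
  rcases h.num_ne_zero_or_den_ne_zero z with hz | hz
  · exact hz (by rw [hN, hD, mul_zero])
  · exact hz hD

theorem continuousAt_Gam {τ σ z : ℂ} (hτ : τ.im ≠ 0) (hσ : σ.im ≠ 0) (hz : ¬ IsPole z τ σ) :
    ContinuousAt (fun w => Gam w τ σ) z := by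
  obtain ⟨N, D, h⟩ := exists_isReducedQuotient hτ hσ
  obtain ⟨c, hc⟩ := tendsto_nhds_of_meromorphicOrderAt_nonneg
    (meromorphic_Gam_comp hτ hσ differentiable_id z) (not_lt.1 hz)
  have hN := (h.differentiable_num z).continuousAt
  have hD := (h.differentiable_den z).continuousAt
  have hcountable := countable_addSubgroupClosure (Set.toFinite {1, τ, σ}).countable
  have hlim : N z = c * D z := by
    refine tendsto_nhds_unique_of_frequently_eq (hN.tendsto.mono_left nhdsWithin_le_nhds)
      (hc.mul (hD.tendsto.mono_left nhdsWithin_le_nhds))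
      ((frequently_notMem_nhdsNE hcountable z).mono fun w hw => ?_)
    rw [id, h.Gam_eq_div, div_mul_cancel₀ _ (h.ne_zero_of_notMem hτ hσ hw).2]
  simp only [h.Gam_eq_div]
  exact hN.div hD (h.den_ne_zero_of_num_eq hlim)

theorem continuousAt_Gam_comp {τ σ z : ℂ} (hτ : τ.im ≠ 0) (hσ : σ.im ≠ 0) {g : ℂ → ℂ}
    (hg : Differentiable ℂ g) (hz : ¬ IsPole (g z) τ σ) :
    ContinuousAt (fun w => Gam (g w) τ σ) z :=
  (continuousAt_Gam hτ hσ hz).comp (f := g) (hg z).continuousAt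

theorem Gam_comp_eq_of_continuousAt {τ σ : ℂ} (hτ : τ.im ≠ 0) (hσ : σ.im ≠ 0) {f g : ℂ → ℂ}
    (hg : Differentiable ℂ g) {S : Set ℂ} (hS : S.Countable)
    (hSg : ∀ z ∉ S, g z ∉ AddSubgroup.closure {1, τ, σ}) (h : ∀ z ∉ S, Gam (g z) τ σ = f z)
    {z : ℂ} (hf : ContinuousAt f z) : Gam (g z) τ σ = f z := by
  obtain ⟨N, D, hr⟩ := exists_isReducedQuotient hτ hσ
  have hlim : N (g z) = f z * D (g z) := by
    refine tendsto_nhds_unique_of_frequently_eq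
      ((hr.differentiable_num.comp hg) z).continuousAt.tendsto
      (hf.tendsto.mul ((hr.differentiable_den.comp hg) z).continuousAt.tendsto)
      ((mem_closure_iff_frequently.1 (hS.dense_compl ℂ z)).mono fun w hw => ?_)
    rw [← h w hw, hr.Gam_eq_div]
    exact (div_mul_cancel₀ _ (hr.ne_zero_of_notMem hτ hσ (hSg w hw)).2).symm
  rw [hr.Gam_eq_div, hlim, mul_div_cancel_right₀ _ (hr.den_ne_zero_of_num_eq hlim)]

theorem meroEq_Gam_comp_and_forall {τ σ : ℂ} (hτ : τ.im ≠ 0) (hσ : σ.im ≠ 0) {f g : ℂ → ℂ}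
    (hf : Meromorphic f) (hg : Differentiable ℂ g) {S : Set ℂ} (hS : S.Countable)
    (hSg : ∀ z ∉ S, g z ∉ AddSubgroup.closure {1, τ, σ}) (h : ∀ z ∉ S, Gam (g z) τ σ = f z) :
    MeroEq (fun z => Gam (g z) τ σ) f ∧ ∀ z, ContinuousAt f z → Gam (g z) τ σ = f z :=
  have hGam := meromorphic_Gam_comp hτ hσ hg
  ⟨⟨hGam, hf, eventuallyEq_codiscrete_of_countable hGam hf hS h⟩,
    fun _ => Gam_comp_eq_of_continuousAt hτ hσ hg hS hSg h⟩

theorem Q_comm (z τ σ : ℂ) : Q z σ τ = Q z τ σ := by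
  unfold Q; ring

theorem Gam_modular {τ σ : ℂ} (hτ : τ.im ≠ 0) (hσ : σ.im ≠ 0) (hστ : (σ / τ).im ≠ 0) :
    MeroEq (fun z => Gam (z / σ) (τ / σ) (-1 / σ))
      (fun z => Complex.exp (Complex.I * Real.pi * Q z τ σ) *
        Gam ((z - σ) / τ) (-1 / τ) (-σ / τ) * Gam z τ σ) ∧
    ∀ z : ℂ, ¬ IsPole ((z - σ) / τ) (-1 / τ) (-σ / τ) → ¬ IsPole z τ σ →
      Gam (z / σ) (τ / σ) (-1 / σ) = Complex.exp (Complex.I * Real.pi * Q z τ σ) *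
        Gam ((z - σ) / τ) (-1 / τ) (-σ / τ) * Gam z τ σ := by
  have hσ0 : σ ≠ 0 := by rintro rfl; simp at hσ
  have im_neg_div {x y : ℂ} (h : (x / y).im ≠ 0) : (-x / y).im ≠ 0 := by
    rwa [neg_div, Complex.neg_im, neg_ne_zero]
  have h1τ : (-1 / τ).im ≠ 0 := im_neg_div (im_div_ne_zero_symm (by rwa [div_one]))
  have h1σ : (-1 / σ).im ≠ 0 := im_neg_div (im_div_ne_zero_symm (by rwa [div_one]))
  have hdiv (s d : ℂ) : Differentiable ℂ fun z : ℂ => (z - s) / d := by fun_prop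
  have hexp : Differentiable ℂ fun z => Complex.exp (Complex.I * Real.pi * Q z τ σ) := by
    unfold Q; fun_prop
  have hmero : Meromorphic fun z => Complex.exp (Complex.I * Real.pi * Q z τ σ) *
      Gam ((z - σ) / τ) (-1 / τ) (-σ / τ) * Gam z τ σ := fun z =>
    ((hexp.analyticAt z).meromorphicAt.mul
      (meromorphic_Gam_comp h1τ (im_neg_div hστ) (hdiv σ τ) z)).mul
      (meromorphic_Gam_comp hτ hσ differentiable_id z)
  have hnotMem (z : ℂ) (hz : z ∉ AddSubgroup.closure {1, τ, σ}) :
      z / σ ∉ AddSubgroup.closure {1, τ / σ, -1 / σ} := by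
    refine div_notMem_addSubgroupClosure hσ0 (fun w hw => ?_) hz
    rcases hw with rfl | rfl | rfl
    · exact AddSubgroup.mem_closure_of_mem (by simp)
    · exact AddSubgroup.mem_closure_of_mem (by simp [mul_div_cancel₀ _ hσ0])
    · rw [mul_div_cancel₀ _ hσ0]
      exact neg_mem (AddSubgroup.mem_closure_of_mem (by simp))
  obtain ⟨hmeroEq, hvalues⟩ := meroEq_Gam_comp_and_forall (im_div_ne_zero_symm hστ) h1σ hmero
    (differentiable_id.div_const σ) (countable_addSubgroupClosure (Set.toFinite _).countable)
    hnotMem fun z => Gam_modular_of_notMem hτ hσ hστ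
  exact ⟨hmeroEq, fun z hz₁ hz₂ => hvalues z <| ((hexp z).continuousAt.mul
    (continuousAt_Gam_comp h1τ (im_neg_div hστ) (hdiv σ τ) hz₁)).mul (continuousAt_Gam hτ hσ hz₂)⟩

theorem Gam_additive {τ σ : ℂ} (hτ : τ.im ≠ 0) (hσ : σ.im ≠ 0) (hadd : (τ + σ).im ≠ 0) :
    MeroEq (fun z => Gam z (τ + σ) σ) (fun z => Gam z τ σ / Gam (z + τ) τ (σ + τ)) ∧
    ∀ z : ℂ, ¬ IsPole z τ σ → ¬ IsPole (z + τ) τ (σ + τ) → Gam (z + τ) τ (σ + τ) ≠ 0 →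
      Gam z (τ + σ) σ = Gam z τ σ / Gam (z + τ) τ (σ + τ) := by
  have hadd' : (σ + τ).im ≠ 0 := by rwa [add_comm]
  have hshift : Differentiable ℂ fun z => z + τ := differentiable_id.add_const τ
  have hmero : Meromorphic fun z => Gam z τ σ / Gam (z + τ) τ (σ + τ) := fun z =>
    (meromorphic_Gam_comp hτ hσ differentiable_id z).div (meromorphic_Gam_comp hτ hadd' hshift z)
  obtain ⟨hmeroEq, hvalues⟩ := meroEq_Gam_comp_and_forall hadd hσ hmero differentiable_id
    (countable_addSubgroupClosure (Set.toFinite {1, τ, σ}).countable)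
    (fun z hz hmem => hz (addSubgroupClosure_one_add_le τ σ hmem))
    fun z hz => eq_div_of_mul_eq (Gam_add_ne_zero hτ hadd hz)
      (Gam_eq_mul_of_notMem hτ hσ hadd hz).symm
  exact ⟨hmeroEq, fun z hz₁ hz₂ hz₃ => hvalues z <|
    (continuousAt_Gam hτ hσ hz₁).div (continuousAt_Gam_comp hτ hadd' hshift hz₂) hz₃⟩

end EllipticGamma

theorem mainTheorem1 (τ σ : ℂ) (hτ : τ.im ≠ 0) (hσ : σ.im ≠ 0)
    (hστ : (σ / τ).im ≠ 0) (hadd : (τ + σ).im ≠ 0) :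
    -- periodicity in the parameters, at every point `z`
    (∀ z : ℂ, EllipticGamma.Gam z (τ + 1) σ = EllipticGamma.Gam z τ σ ∧
      EllipticGamma.Gam z τ (σ + 1) = EllipticGamma.Gam z τ σ) ∧
    -- the three-term relations, as identities between meromorphic functions of `z`
    EllipticGamma.MeroEq
      (fun z => EllipticGamma.Gam z (τ + σ) σ)
      (fun z => EllipticGamma.Gam z τ σ / EllipticGamma.Gam (z + τ) τ (σ + τ)) ∧
    EllipticGamma.MeroEq
      (fun z => EllipticGamma.Gam (z / σ) (τ / σ) (-1 / σ))
      (fun z => Complex.exp (Complex.I * Real.pi * EllipticGamma.Q z τ σ) *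
        EllipticGamma.Gam ((z - σ) / τ) (-1 / τ) (-σ / τ) * EllipticGamma.Gam z τ σ) ∧
    EllipticGamma.MeroEq
      (fun z => EllipticGamma.Gam (z / τ) (-1 / τ) (σ / τ))
      (fun z => Complex.exp (Complex.I * Real.pi * EllipticGamma.Q z τ σ) *
        EllipticGamma.Gam ((z - τ) / σ) (-τ / σ) (-1 / σ) * EllipticGamma.Gam z τ σ) ∧
    -- the same relations between values, at every point where the right-hand side is defined
    (∀ z : ℂ, ¬ EllipticGamma.IsPole z τ σ → ¬ EllipticGamma.IsPole (z + τ) τ (σ + τ) →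
      EllipticGamma.Gam (z + τ) τ (σ + τ) ≠ 0 →
      EllipticGamma.Gam z (τ + σ) σ =
        EllipticGamma.Gam z τ σ / EllipticGamma.Gam (z + τ) τ (σ + τ)) ∧
    (∀ z : ℂ, ¬ EllipticGamma.IsPole ((z - σ) / τ) (-1 / τ) (-σ / τ) →
      ¬ EllipticGamma.IsPole z τ σ →
      EllipticGamma.Gam (z / σ) (τ / σ) (-1 / σ) =
        Complex.exp (Complex.I * Real.pi * EllipticGamma.Q z τ σ) *
          EllipticGamma.Gam ((z - σ) / τ) (-1 / τ) (-σ / τ) * EllipticGamma.Gam z τ σ) ∧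
    (∀ z : ℂ, ¬ EllipticGamma.IsPole ((z - τ) / σ) (-τ / σ) (-1 / σ) →
      ¬ EllipticGamma.IsPole z τ σ →
      EllipticGamma.Gam (z / τ) (-1 / τ) (σ / τ) =
        Complex.exp (Complex.I * Real.pi * EllipticGamma.Q z τ σ) *
          EllipticGamma.Gam ((z - τ) / σ) (-τ / σ) (-1 / σ) * EllipticGamma.Gam z τ σ) := by
  have h2 := EllipticGamma.Gam_additive hτ hσ hadd
  have h3 := EllipticGamma.Gam_modular hτ hσ hστ
  have h4 := EllipticGamma.Gam_modular hσ hτ (EllipticGamma.im_div_ne_zero_symm hστ)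
  simp only [EllipticGamma.Q_comm, EllipticGamma.Gam_comm _ (σ / τ),
    EllipticGamma.Gam_comm _ (-1 / σ), EllipticGamma.Gam_comm _ σ τ,
    EllipticGamma.isPole_comm _ (-1 / σ), EllipticGamma.isPole_comm _ σ τ] at h4
  exact ⟨fun z => ⟨EllipticGamma.Gam_add_one_left z τ σ, EllipticGamma.Gam_add_one_right z τ σ⟩,
    h2.1, h3.1, h4.1, h2.2, h3.2, h4.2⟩
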